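/- **Setting.** Let $n_1,n_2,n_3\ge 1$. Let $\mathcal L$ be an invertible discrete transform on tubes of length $n_3$, $\mathcal L(\boldsymbol a)=\boldsymbol M\boldsymbol a$, where $\boldsymbol M$ is an invertible $n_3\times n_3$ matrix that is real or, more generally, complex with the conjugate of every row again a row (as for the DFT), so that the operations below take real tensors to real tensors. For tubes put $\boldsymbol a\bullet\boldsymbol b=\mathcal L^{-1}(\mathcal L(\boldsymbol a)\circ\mathcal L(\boldsymbol b))$ with $\circ$ the entrywise product. For real third-order tensors let $(\mathcal A\bullet\mathcal B)(i,j,:)=\sum_s\mathcal A(i,s,:)\bullet\mathcal B(s,j,:)$; let $\mathcal A^\dagger$ be the tensor such that each frontal slice of $\mathcal L(\mathcal A^\dagger)$ is the conjugate transpose of the corresponding frontal slice of $\mathcal L(\mathcal A)$; inverses are taken with respect to the identity tensor, whose diagonal tubes are $\mathcal L^{-1}(1,\dots,1)$ and whose other tubes vanish. Let $\mathcal U\in\mathbb R^{n_1\times n_2\times n_3}$ be such that $\mathcal U^\dagger\bullet\mathcal U$ is invertible (for example the identity), let $\mathcal S\subset\mathbb R^{n_1\times1\times n_3}$ be the set of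 all $\mathcal U_1\bullet\boldsymbol c_1+\dots+\mathcal U_{n_2}\bullet\boldsymbol c_{n_2}$, where $\mathcal U_j$ are the tensor columns of $\mathcal U$ and $\boldsymbol c_j$ are arbitrary tubes, let $\mathcal S^\perp=\{\mathcal Y:\ \mathcal Z^\dagger\bullet\mathcal Y=0\ \text{for all}\ \mathcal Z\in\mathcal S\}$ and $\mathcal P=\mathcal U\bullet(\mathcal U^\dagger\bullet\mathcal U)^{-1}\bullet\mathcal U^\dagger$. Let $\mathrm{unfold}(\mathcal T)\in\mathbb R^{n_1n_3}$ be the vector of the entries of $\mathcal T\in\mathbb R^{n_1\times1\times n_3}$, indexed by $[n_1]\times[n_3]$, and let $\boldsymbol U=\mathrm{lmat}(\mathcal U)$ be the $n_1n_3\times n_2n_3$ matrix with $\mathrm{unfold}(\mathcal U\bullet\mathcal C)=\boldsymbol U\,\mathrm{unfold}(\mathcal C)$ for all $\mathcal C\in\mathbb R^{n_2\times 1\times n_3}$. Let $\boldsymbol S\subset\mathbb R^{n_1n_3}$ be the column space of $\boldsymbol U$, $\boldsymbol S^\perp$ its Euclidean orthogonal complement, $\boldsymbol P_{\boldsymbol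 S},\boldsymbol P_{\boldsymbol S^\perp}$ the orthogonal projections, and $\mu(\boldsymbol S)=\frac{n_1}{n_2}\max_j\|\boldsymbol P_{\boldsymbol S}\boldsymbol e_j\|_2^2$ with $\boldsymbol e_j$ the standard basis vectors of $\mathbb R^{n_1n_3}$. Let $\mathcal T=\mathcal X+\mathcal Y$ with $\mathcal X\in\mathcal S$ and $\mathcal Y\in\mathcal S^\perp$, let $\boldsymbol t=\mathrm{unfold}(\mathcal T)$ and $\boldsymbol y=\boldsymbol P_{\boldsymbol S^\perp}\boldsymbol t$, and let $\theta$ be the principal angle between $\mathrm{unfold}(\mathcal Y)$ and $\boldsymbol S^\perp$, that is, $\cos\theta=\|\boldsymbol P_{\boldsymbol S^\perp}\mathrm{unfold}(\mathcal Y)\|_2/\|\mathrm{unfold}(\mathcal Y)\|_2$. **Sampling.** Let $\Omega(1),\dots,\Omega(m)$ be independent and uniformly distributed on $[n_1]\times[n_3]$ (elementwise sampling with replacement). Let $\boldsymbol t_\Omega\in\mathbb R^m$ have the coordinates $\boldsymbol t_{\Omega(k)}$, let $\boldsymbol U_\Omega\in\mathbb R^{m\times n_2n_3}$ have as its rows the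 rows of $\boldsymbol U$ with indices $\Omega(k)$, $k\in[m]$ (repeated draws are repeated), and let $\boldsymbol P_\Omega=\boldsymbol U_\Omega(\boldsymbol U_\Omega^{H}\boldsymbol U_\Omega)^{-1}\boldsymbol U_\Omega^{H}$. **Theorem.** Let $\delta>0$ and $m\ge\frac83 n_2n_3\,\mu(\boldsymbol S)\log\frac{2n_2n_3}{\delta}$. Then with probability at least $1-4\delta$ the matrix $\boldsymbol U_\Omega^{H}\boldsymbol U_\Omega$ is invertible and $$\frac{m(1-\alpha)-n_2n_3\,\mu(\boldsymbol S)\frac{\beta}{1-\gamma}}{n_1n_3}\cos^2(\theta)\,\|\mathcal T-\mathcal P\bullet\mathcal T\|_F^2\ \le\ \|\boldsymbol t_\Omega-\boldsymbol P_\Omega\boldsymbol t_\Omega\|_2^2\ \le\ (1+\alpha)\frac{m}{n_1n_3}\cos^2(\theta)\,\|\mathcal T-\mathcal P\bullet\mathcal T\|_F^2,$$ where $$\alpha=\sqrt{\frac{2(n_1n_3\|\boldsymbol y\|_\infty^2-\|\boldsymbol y\|_2^2)}{m\|\boldsymbol y\|_2^2}\log\frac1\delta}+\frac{2(n_1n_3\|\boldsymbol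 y\|_\infty^2-\|\boldsymbol y\|_2^2)}{3m\|\boldsymbol y\|_2^2}\log\frac1\delta,$$ $$\beta=\Big(1+2\sqrt{\log\tfrac1\delta}\Big)^2,\qquad \gamma=\sqrt{\frac{8n_2n_3\,\mu(\boldsymbol S)}{3m}\log\frac{2n_2n_3}{\delta}}.$$ If $\gamma=1$ (equality in the condition on $m$), the lower bound is void. If $\boldsymbol y=0$ (or $\mathcal Y=0$), both bounds are read as $0$. -/

import Mathlib

open scoped Matrix

noncomputable section

/-- An invertible discrete transform on tubes of length `n`, given by its (complex) matrix `M`.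
The condition `conj_row` (the complex conjugate of every row of `M` is again a row of `M`) says that
the transform-domain operations (entrywise product and conjugation) take real tubes to real tubes,
see `transform_tubeMul`, `transform_tubeStar` and `transform_tubeOne` below. It holds for every real
matrix `M` and for the discrete Fourier matrix. -/
structure DiscreteTransform (n : ℕ) where
  M : Matrix (Fin n) (Fin n) ℂ
  isUnit_det : IsUnit M.det
  conj_row : ∀ i, ∃ i', ∀ j, M i' j = starRingEnd ℂ (M i j)

/-- Every invertible real matrix is a discrete transform. -/
def DiscreteTransform.ofReal {n : ℕ} (A : Matrix (Fin n) (Fin n) ℝ) (hA : IsUnit A.det) :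
    DiscreteTransform n where
  M := A.map Complex.ofRealHom
  isUnit_det := by
    have h : (A.map Complex.ofRealHom).det = Complex.ofRealHom A.det :=
      (RingHom.map_det Complex.ofRealHom A).symm
    rw [h]
    exact hA.map Complex.ofRealHom
  conj_row := fun i => ⟨i, fun j => by simp⟩

/-- Real third-order tensors of size `n₁ × n₂ × n₃`; `A i j` is the tube `A(i,j,:)`. -/
abbrev Tensor (n₁ n₂ n₃ : ℕ) : Type := Fin n₁ → Fin n₂ → Fin n₃ → ℝ

variable {n : ℕ}

/-- The transform `L(a)` of a real tube. -/
def DiscreteTransform.transform (L : DiscreteTransform n) (a : Fin n → ℝ) : Fin n → ℂ :=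
  L.M *ᵥ (fun j => (a j : ℂ))

/-- The inverse transform `L⁻¹(v)`; it is only applied to transforms of real tubes, for which
`M⁻¹ v` is real. -/
def DiscreteTransform.invTransform (L : DiscreteTransform n) (v : Fin n → ℂ) : Fin n → ℝ :=
  fun k => ((L.M⁻¹ *ᵥ v) k).re

/-- Tube multiplication `a • b = L⁻¹(L(a) ∘ L(b))`. -/
def tubeMul (L : DiscreteTransform n) (a b : Fin n → ℝ) : Fin n → ℝ :=
  L.invTransform (fun k => L.transform a k * L.transform b k)

/-- The tube whose transform is the entrywise complex conjugate of `L(a)`. -/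
def tubeStar (L : DiscreteTransform n) (a : Fin n → ℝ) : Fin n → ℝ :=
  L.invTransform (fun k => starRingEnd ℂ (L.transform a k))

/-- The unit tube `e = L⁻¹(1)`. -/
def tubeOne (L : DiscreteTransform n) : Fin n → ℝ :=
  L.invTransform (fun _ => 1)

theorem DiscreteTransform.transform_invTransform (L : DiscreteTransform n) (v : Fin n → ℂ)
    (hv : ∀ i i', (∀ j, L.M i' j = starRingEnd ℂ (L.M i j)) → v i' = starRingEnd ℂ (v i)) :
    L.transform (L.invTransform v) = v := by
  have hu : IsUnit L.M := (Matrix.isUnit_iff_isUnit_det _).2 L.isUnit_det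
  have hinj : Function.Injective (fun u : Fin n → ℂ => L.M *ᵥ u) :=
    Matrix.mulVec_injective_of_isUnit hu
  choose σ hσ using L.conj_row
  have hσi : Function.Injective σ := by
    intro i j hij
    have hrow : L.M i = L.M j := by
      funext k
      have h1 := hσ i k
      have h2 := hσ j k
      rw [hij, h2] at h1
      exact ((starRingEnd ℂ).injective h1).symm
    by_contra hne
    exact L.isUnit_det.ne_zero (Matrix.det_zero_of_row_eq hne hrow)
  have hσs : Function.Surjective σ := Finite.surjective_of_injective hσi
  have hMu : L.M *ᵥ (L.M⁻¹ *ᵥ v) = v := by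
    rw [Matrix.mulVec_mulVec, Matrix.mul_nonsing_inv _ L.isUnit_det, Matrix.one_mulVec]
  have hconj : L.M *ᵥ (fun k => starRingEnd ℂ ((L.M⁻¹ *ᵥ v) k)) = v := by
    funext i'
    obtain ⟨i, rfl⟩ := hσs i'
    rw [hv i (σ i) (hσ i)]
    conv_rhs => rw [← hMu]
    simp only [Matrix.mulVec, dotProduct, map_sum, map_mul]
    exact Finset.sum_congr rfl fun j _ => by rw [hσ i j]
  have hreal : (fun k => starRingEnd ℂ ((L.M⁻¹ *ᵥ v) k)) = L.M⁻¹ *ᵥ v := hinj (by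
    change L.M *ᵥ _ = L.M *ᵥ _
    rw [hconj, hMu])
  have hre : (fun k => ((L.invTransform v k : ℝ) : ℂ)) = L.M⁻¹ *ᵥ v := by
    funext k
    exact Complex.conj_eq_iff_re.1 (congrFun hreal k)
  rw [DiscreteTransform.transform, hre, hMu]

theorem DiscreteTransform.transform_conj (L : DiscreteTransform n) (a : Fin n → ℝ) (i i' : Fin n)
    (h : ∀ j, L.M i' j = starRingEnd ℂ (L.M i j)) :
    L.transform a i' = starRingEnd ℂ (L.transform a i) := by
  simp [DiscreteTransform.transform, Matrix.mulVec, dotProduct, h]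

theorem transform_tubeMul (L : DiscreteTransform n) (a b : Fin n → ℝ) :
    L.transform (tubeMul L a b) = fun k => L.transform a k * L.transform b k :=
  L.transform_invTransform _ fun i i' h => by
    rw [L.transform_conj a i i' h, L.transform_conj b i i' h, map_mul]

theorem transform_tubeStar (L : DiscreteTransform n) (a : Fin n → ℝ) :
    L.transform (tubeStar L a) = fun k => starRingEnd ℂ (L.transform a k) :=
  L.transform_invTransform _ fun i i' h => by
    rw [L.transform_conj a i i' h]

theorem transform_tubeOne (L : DiscreteTransform n) :
    L.transform (tubeOne L) = fun _ => 1 :=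
  L.transform_invTransform _ fun i i' _ => by simp

variable {n₁ n₂ n₃ n₄ : ℕ}

/-- The `L`-product of tensors, `C(i,j,:) = ∑ₛ A(i,s,:) • B(s,j,:)`. -/
def tensorMul (L : DiscreteTransform n₃) (A : Tensor n₁ n₂ n₃) (B : Tensor n₂ n₄ n₃) :
    Tensor n₁ n₄ n₃ :=
  fun i j => ∑ s, tubeMul L (A i s) (B s j)

/-- The tensor transpose: each frontal slice of `L(A†)` is the conjugate transpose of the
corresponding frontal slice of `L(A)`. -/
def tensorTranspose (L : DiscreteTransform n₃) (A : Tensor n₁ n₂ n₃) : Tensor n₂ n₁ n₃ :=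
  fun j i => tubeStar L (A i j)

/-- The identity tensor. -/
def tensorId (L : DiscreteTransform n₃) (k : ℕ) : Tensor k k n₃ :=
  fun i j => if i = j then tubeOne L else 0

/-- `B` is the (two-sided) inverse of the square tensor `A`. -/
def IsTensorInverse (L : DiscreteTransform n₃) (A B : Tensor n₁ n₁ n₃) : Prop :=
  tensorMul L A B = tensorId L n₁ ∧ tensorMul L B A = tensorId L n₁

/-- The Frobenius norm. -/
def frobNorm (A : Tensor n₁ n₂ n₃) : ℝ :=
  Real.sqrt (∑ i, ∑ j, ∑ k, A i j k ^ 2)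

/-- The tensor-column subspace spanned by the tensor columns of `U`:
all `U₁ • c₁ + ⋯ + U_{n₂} • c_{n₂}` with arbitrary tubes `c₁, …, c_{n₂}`. -/
def tensorColumnSpace (L : DiscreteTransform n₃) (U : Tensor n₁ n₂ n₃) : Set (Tensor n₁ 1 n₃) :=
  {X | ∃ c : Fin n₂ → Fin n₃ → ℝ, X = fun i _ => ∑ j, tubeMul L (U i j) (c j)}

/-- The orthogonal subspace of a set of tensor columns, for the tube-valued pairing `Z† • Y`. -/
def tensorOrthogonal (L : DiscreteTransform n₃) (S : Set (Tensor n₁ 1 n₃)) :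
    Set (Tensor n₁ 1 n₃) :=
  {Y | ∀ Z ∈ S, tensorMul L (tensorTranspose L Z) Y = 0}

/-- The vector of all entries of a tensor column; the entry in row `i` of the `k`-th frontal slice
has index `(i, k)`. -/
def unfold (T : Tensor n₁ 1 n₃) : EuclideanSpace ℝ (Fin n₁ × Fin n₃) :=
  WithLp.toLp 2 fun p => T p.1 0 p.2

/-- The block matrix of the linear map `C ↦ U • C` on unfolded tensor columns: the column with index
`(s, l)` is the unfolding of `U • E`, with `E` the tensor column whose only non-zero entry is a `1`
in row `s` of the `l`-th frontal slice. See `unfold_tensorMul`. -/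
def lmat (L : DiscreteTransform n₃) (U : Tensor n₁ n₂ n₃) :
    Matrix (Fin n₁ × Fin n₃) (Fin n₂ × Fin n₃) ℝ :=
  Matrix.of fun p q => tubeMul L (U p.1 q.1) (Pi.single q.2 1) p.2

theorem tubeMul_eq_sum (L : DiscreteTransform n) (a c : Fin n → ℝ) (k : Fin n) :
    tubeMul L a c k = ∑ l, tubeMul L a (Pi.single l 1) k * c l := by
  have hsingle : ∀ l i, L.transform (Pi.single l 1) i = L.M i l := by
    intro l i
    have : (fun j => ((Pi.single l (1 : ℝ) : Fin n → ℝ) j : ℂ)) = Pi.single l 1 := by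
      funext j
      by_cases h : j = l
      · subst h; simp
      · simp [Pi.single_eq_of_ne h]
    simp [DiscreteTransform.transform, this]
  simp only [tubeMul, DiscreteTransform.invTransform, hsingle]
  have hre : ∀ (z : ℂ) (r : ℝ), z.re * r = (z * r).re := fun z r => by simp
  simp only [hre]
  rw [← Complex.re_sum]
  congr 1
  simp only [Matrix.mulVec, dotProduct, Finset.sum_mul]
  rw [Finset.sum_comm]
  refine Finset.sum_congr rfl fun i _ => ?_
  simp only [DiscreteTransform.transform, Matrix.mulVec, dotProduct, Finset.mul_sum]
  exact Finset.sum_congr rfl fun j _ => by ring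

/-- The property that characterizes `lmat`: `unfold (U • C) = lmat(U) · unfold C`. -/
theorem unfold_tensorMul (L : DiscreteTransform n₃) (U : Tensor n₁ n₂ n₃) (C : Tensor n₂ 1 n₃) :
    unfold (tensorMul L U C) = WithLp.toLp 2 (lmat L U *ᵥ (unfold C).ofLp) := by
  unfold unfold
  congr 1
  funext p
  simp only [tensorMul, Finset.sum_apply, lmat, Matrix.mulVec, dotProduct, Matrix.of_apply,
    Fintype.sum_prod_type]
  exact Finset.sum_congr rfl fun s _ => tubeMul_eq_sum L _ _ _

/-- The vector subspace spanned by the columns of `lmat(U)`. -/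
def vectorSubspace (L : DiscreteTransform n₃) (U : Tensor n₁ n₂ n₃) :
    Submodule ℝ (EuclideanSpace ℝ (Fin n₁ × Fin n₃)) :=
  Submodule.span ℝ (Set.range fun q => WithLp.toLp 2 fun p => lmat L U p q)

/-- The coherence `(n₁ / n₂) max_j ‖P_S e_j‖²` of an `n₂ n₃`-dimensional subspace of `ℝ^(n₁ n₃)`. -/
def coherence (n₂ : ℕ) (S : Submodule ℝ (EuclideanSpace ℝ (Fin n₁ × Fin n₃))) : ℝ :=
  (n₁ : ℝ) / n₂ * ⨆ j, ‖S.starProjection (EuclideanSpace.single j 1)‖ ^ 2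

/-- The largest absolute value of the entries of a vector. -/
def maxAbs (y : EuclideanSpace ℝ (Fin n₁ × Fin n₃)) : ℝ := ⨆ j, |y j|

/-- The cosine of the principal angle between a vector `v` and a subspace `W`. -/
def cosAngle (v : EuclideanSpace ℝ (Fin n₁ × Fin n₃))
    (W : Submodule ℝ (EuclideanSpace ℝ (Fin n₁ × Fin n₃))) : ℝ :=
  ‖W.starProjection v‖ / ‖v‖

variable {m : ℕ}

/-- The sampled vector `t_Ω`, one coordinate for each of the `m` draws (a repeated draw is
repeated). -/
def sampleVec (Ω : Fin m → Fin n₁ × Fin n₃) (t : EuclideanSpace ℝ (Fin n₁ × Fin n₃)) : Fin m → ℝ :=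
  fun k => t (Ω k)

/-- The sampled matrix `U_Ω`, one row for each of the `m` draws. -/
def sampleMat {κ : Type} (Ω : Fin m → Fin n₁ × Fin n₃) (U : Matrix (Fin n₁ × Fin n₃) κ ℝ) :
    Matrix (Fin m) κ ℝ :=
  U.submatrix Ω id

/-- The projection `P_Ω = U_Ω (U_Ωᵀ U_Ω)⁻¹ U_Ωᵀ`, meaningful if `U_Ωᵀ U_Ω` is invertible. -/
def sampleProj {κ : Type} [Fintype κ] [DecidableEq κ] (Ω : Fin m → Fin n₁ × Fin n₃)
    (U : Matrix (Fin n₁ × Fin n₃) κ ℝ) : Matrix (Fin m) (Fin m) ℝ :=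
  sampleMat Ω U * ((sampleMat Ω U)ᵀ * sampleMat Ω U)⁻¹ * (sampleMat Ω U)ᵀ

/-- The estimator `‖t_Ω - P_Ω t_Ω‖₂²`. -/
def residualEnergy {κ : Type} [Fintype κ] [DecidableEq κ] (Ω : Fin m → Fin n₁ × Fin n₃)
    (U : Matrix (Fin n₁ × Fin n₃) κ ℝ) (t : EuclideanSpace ℝ (Fin n₁ × Fin n₃)) : ℝ :=
  ∑ k, (sampleVec Ω t k - (sampleProj Ω U *ᵥ sampleVec Ω t) k) ^ 2

end

/-! The tensor projection fixes `X` and kills `Y`, so `T - P • T = Y`. As `unfold X` lies in `S`,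
the factor `cos² θ` turns `‖Y‖²` into `‖y‖²`, and the claim becomes one about a vector `y ∈ Sᗮ`
sampled with replacement from its `N = n₁ n₃` coordinates. The residual of `t_Ω` is the least
squares residual of `y_Ω`. Hence it is at most `‖y_Ω‖²`, and at least `‖y_Ω‖² - ‖w‖² / λ`, where `w
= ∑ y_{Ω(k)} P_S e_{Ω(k)}` and `λ` satisfies `‖s_Ω‖² ≥ λ ‖s‖²` on `S` (`exists_residualEnergy_eq`,
`sub_div_le_sum_sub_sq`).

Four bad events, each of probability at most `δ`, remain: `‖y_Ω‖²` too large or too small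
(`card_bernstein`), `‖w‖` too large (`card_bernstein_vector`; the summands have mean `P_S y / N =
0`), and failure of `λ = (1 - γ) m / N` (`card_matrix_chernoff`). The three inequalities share one
mechanism, `sum_samples_le_pow_mul`: a potential (`exp`, `cosh ‖·‖`, or the trace of a matrix
exponential) changes on average by at most a fixed factor when a draw is added, and Markov's
inequality concludes. For matrices the one-step bound needs the Golden–Thompson inequality, obtained
from the Lie–Trotter formula and trace inequalities for powers. Samples are counted; probability
enters only through `measureReal_sample_eq`.

The lower Bernstein tail carries a term `‖y‖² log(1/δ) / (3N)` that `α` does not cover. It is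
absorbed by `β`, since `‖w‖²` needs only `1.91` in place of the `2` in `β`. -/

/-! ### Scalar exponential estimates, sums over samples, and Bernstein's inequality. -/

theorem Real.exp_le_one_add_add_sq_div_two_of_nonpos {x : ℝ} (hx : x ≤ 0) :
    Real.exp x ≤ 1 + x + x ^ 2 / 2 := by
  have h := Real.quadratic_le_exp_of_nonneg (neg_nonneg.2 hx)
  have hpos : 0 < 1 + x + x ^ 2 / 2 := by nlinarith [sq_nonneg (1 + x)]
  -- The product of the two quadratics is `1 + x ^ 4 / 4`, so the known bound for `exp (-x)` can be
  -- inverted.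
  have h1 : 1 ≤ (1 + x + x ^ 2 / 2) * (1 + -x + (-x) ^ 2 / 2) := by nlinarith [sq_nonneg (x ^ 2)]
  have h2 : 1 ≤ (1 + x + x ^ 2 / 2) * Real.exp (-x) :=
    h1.trans (mul_le_mul_of_nonneg_left h hpos.le)
  have h3 : Real.exp x * Real.exp (-x) = 1 := by rw [← Real.exp_add]; simp
  exact le_of_mul_le_mul_right (h3.trans_le h2) (Real.exp_pos _)

/-- The estimate of the exponential behind Bernstein's inequality. -/
theorem Real.exp_le_one_add_add_sq_div {x b : ℝ} (hxb : x ≤ b) (hb : 0 ≤ b) (hb3 : b < 3) :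
    Real.exp x ≤ 1 + x + x ^ 2 / (2 * (1 - b / 3)) := by
  rcases le_total x 0 with hx | hx
  · refine (Real.exp_le_one_add_add_sq_div_two_of_nonpos hx).trans ?_
    gcongr
    · linarith
    · linarith
  -- Since `2 * 3 ^ k ≤ (k + 2)!`, the series from the quadratic term on is dominated by a geometric
  -- series of ratio `b / 3`.
  · have hs : HasSum (fun k : ℕ => x ^ (k + 2) / ((k + 2).factorial : ℝ)) (Real.exp x - 1 - x) := by
      have h0 : HasSum (fun k : ℕ => x ^ k / (k.factorial : ℝ)) (Real.exp x) := by
        rw [Real.exp_eq_exp_ℝ]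
        exact NormedSpace.expSeries_div_hasSum_exp x
      have := (hasSum_nat_add_iff' 2).2 h0
      simpa [Finset.sum_range_succ, sub_sub] using this
    have hg : HasSum (fun k : ℕ => x ^ 2 / 2 * (b / 3) ^ k) (x ^ 2 / 2 * (1 - b / 3)⁻¹) :=
      (hasSum_geometric_of_lt_one (by positivity) (by linarith)).mul_left _
    have hle := hasSum_le (fun k => ?_) hs hg
    · have : x ^ 2 / (2 * (1 - b / 3)) = x ^ 2 / 2 * (1 - b / 3)⁻¹ := by
        rw [div_mul_eq_div_div, div_eq_mul_inv (x ^ 2 / 2)]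
      linarith
    · have hf : (2 : ℝ) * 3 ^ k ≤ ((k + 2).factorial : ℝ) := by
        have := Nat.factorial_mul_pow_le_factorial (m := 2) (n := k)
        rw [add_comm 2 k] at this
        exact_mod_cast this
      calc x ^ (k + 2) / ((k + 2).factorial : ℝ) ≤ x ^ (k + 2) / (2 * 3 ^ k) := by gcongr
        _ = x ^ 2 / 2 * (x / 3) ^ k := by rw [div_pow, pow_add]; field_simp
        _ ≤ x ^ 2 / 2 * (b / 3) ^ k := by gcongr

/-- Optimization of the exponent in Bernstein's inequality. -/
theorem exists_bernstein_parameter {V M L : ℝ} (hV : 0 < V) (hM : 0 ≤ M) (hL : 0 ≤ L) :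
    ∃ l, 0 ≤ l ∧ l * M < 3 ∧
      V * l ^ 2 / (2 * (1 - l * M / 3)) - l * (Real.sqrt (2 * V * L) + M * L / 3) = -L := by
  set a := Real.sqrt (2 * L / V) with ha
  have ha0 : 0 ≤ a := Real.sqrt_nonneg _
  have ha2 : V * a ^ 2 = 2 * L := by
    rw [ha, Real.sq_sqrt (by positivity)]; field_simp
  have hsq : Real.sqrt (2 * V * L) = V * a := by
    rw [Real.sqrt_eq_iff_mul_self_eq (by positivity) (by positivity)]
    linear_combination -V * ha2
  have hc : 0 < 1 + M * a / 3 := by positivity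
  have h1 : 1 - a / (1 + M * a / 3) * M / 3 = 1 / (1 + M * a / 3) := by field_simp; ring
  -- This `l` gives `1 - l * M / 3 = 1 / (1 + M * a / 3)`, and the exponent then collapses to
  -- exactly `-V * a ^ 2 / 2 = -L`.
  refine ⟨a / (1 + M * a / 3), by positivity, ?_, ?_⟩
  · have : 0 < 1 - a / (1 + M * a / 3) * M / 3 := by rw [h1]; positivity
    linarith
  · have hL' : L = V * a ^ 2 / 2 := by linarith
    rw [h1, hsq, hL']
    field_simp
    ring

theorem sum_fin_succ_fun {ι : Type*} [Fintype ι] {m : ℕ} (F : (Fin (m + 1) → ι) → ℝ) :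
    ∑ ω, F ω = ∑ ω : Fin m → ι, ∑ j, F (Fin.cons j ω) := by
  classical
  rw [← (Fin.consEquiv fun _ : Fin (m + 1) => ι).sum_comp, Fintype.sum_prod_type,
    Finset.sum_comm]
  rfl

/-- Iterated one-step bounds for sums over all samples of size `m`. -/
theorem sum_samples_le_pow_mul {ι E : Type*} [Fintype ι] [AddCommMonoid E] (Ψ : E → ℝ) (f : ι → E)
    {c : ℝ} (hc : 0 ≤ c) (h : ∀ s, ∑ j, Ψ (f j + s) ≤ c * Ψ s) (m : ℕ) :
    ∑ ω : Fin m → ι, Ψ (∑ k, f (ω k)) ≤ c ^ m * Ψ 0 := by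
  induction m with
  | zero => simp
  | succ m ih =>
    rw [sum_fin_succ_fun]
    simp only [Fin.sum_univ_succ, Fin.cons_zero, Fin.cons_succ]
    calc _ ≤ ∑ ω : Fin m → ι, c * Ψ (∑ k, f (ω k)) := Finset.sum_le_sum fun ω _ => h _
      _ = c * ∑ ω : Fin m → ι, Ψ (∑ k, f (ω k)) := by rw [Finset.mul_sum]
      _ ≤ c * (c ^ m * Ψ 0) := mul_le_mul_of_nonneg_left ih hc
      _ = c ^ (m + 1) * Ψ 0 := by ring

/-- Markov's inequality for the counting measure. -/
theorem card_filter_mul_le_sum {α : Type*} [Fintype α] (p : α → Prop) [DecidablePred p]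
    (F : α → ℝ) {a : ℝ} (hF : ∀ x, 0 ≤ F x) (h : ∀ x, p x → a ≤ F x) :
    ((Finset.univ.filter p).card : ℝ) * a ≤ ∑ x, F x := by
  calc ((Finset.univ.filter p).card : ℝ) * a = ∑ x ∈ Finset.univ.filter p, a := by simp
    _ ≤ ∑ x ∈ Finset.univ.filter p, F x :=
      Finset.sum_le_sum fun x hx => h x (Finset.mem_filter.1 hx).2
    _ ≤ ∑ x, F x := Finset.sum_le_sum_of_subset_of_nonneg (Finset.filter_subset _ _)
      fun x _ _ => hF x

/-- A sum over a sample vanishes if the variance proxy does. -/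
theorem sum_sample_eq_zero {ι E : Type*} [Fintype ι] [NormedAddCommGroup E] (f : ι → E) {m : ℕ}
    {σ2 : ℝ} (h2 : ∑ j, ‖f j‖ ^ 2 ≤ Fintype.card ι * σ2) (hV : m * σ2 = 0) (ω : Fin m → ι) :
    ∑ k, f (ω k) = 0 := by
  rcases mul_eq_zero.1 hV with hm | hσ
  · have : m = 0 := by exact_mod_cast hm
    subst this
    simp
  · rw [hσ, mul_zero] at h2
    have h0 := (Finset.sum_eq_zero_iff_of_nonneg fun j _ => sq_nonneg ‖f j‖).1
      (le_antisymm h2 (Finset.sum_nonneg fun j _ => sq_nonneg _))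
    refine Finset.sum_eq_zero fun k _ => ?_
    simpa using h0 (ω k) (Finset.mem_univ _)

/-- Bernstein's inequality for samples with replacement from a finite population. -/
theorem card_bernstein {ι : Type*} [Fintype ι] (f : ι → ℝ) {m : ℕ} {M σ2 L : ℝ}
    (hM : 0 ≤ M) (hL : 0 ≤ L) (hσ : 0 ≤ σ2) (h0 : ∑ j, f j = 0) (hf : ∀ j, f j ≤ M)
    (h2 : ∑ j, f j ^ 2 ≤ Fintype.card ι * σ2)
    (p : (Fin m → ι) → Prop) [DecidablePred p]
    (hp : ∀ ω, p ω → Real.sqrt (2 * (m * σ2) * L) + M * L / 3 < ∑ k, f (ω k)) :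
    ((Finset.univ.filter p).card : ℝ) ≤ (Fintype.card ι : ℝ) ^ m * Real.exp (-L) := by
  set t := Real.sqrt (2 * (m * σ2) * L) + M * L / 3 with ht
  have ht0 : 0 ≤ t := by positivity
  rcases (show 0 ≤ m * σ2 by positivity).eq_or_lt with hV | hV
  · have hemp : Finset.univ.filter p = ∅ := by
      refine Finset.filter_eq_empty_iff.2 fun ω _ hpω => ?_
      have := hp ω hpω
      rw [sum_sample_eq_zero f (by simpa using h2) hV.symm ω] at this
      linarith
    rw [hemp]
    simp only [Finset.card_empty, Nat.cast_zero]
    positivity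
  obtain ⟨l, hl0, hl3, hl⟩ := exists_bernstein_parameter hV hM hL
  rw [← ht] at hl
  set q := σ2 * l ^ 2 / (2 * (1 - l * M / 3)) with hq
  have hden : 0 < 2 * (1 - l * M / 3) := by linarith
  have hstep : ∀ s, ∑ j, Real.exp (l * (f j + s))
      ≤ (Fintype.card ι * Real.exp q) * Real.exp (l * s) := by
    intro s
    simp only [mul_add, Real.exp_add]
    rw [← Finset.sum_mul]
    refine mul_le_mul_of_nonneg_right ?_ (Real.exp_pos _).le
    calc ∑ j, Real.exp (l * f j)
        ≤ ∑ j, (1 + l * f j + l ^ 2 / (2 * (1 - l * M / 3)) * f j ^ 2) := by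
          refine Finset.sum_le_sum fun j _ => ?_
          have := Real.exp_le_one_add_add_sq_div (mul_le_mul_of_nonneg_left (hf j) hl0)
            (by positivity) hl3
          refine this.trans (le_of_eq ?_)
          ring
      _ = Fintype.card ι + l ^ 2 / (2 * (1 - l * M / 3)) * ∑ j, f j ^ 2 := by
          rw [Finset.sum_add_distrib, Finset.sum_add_distrib, ← Finset.mul_sum, h0,
            ← Finset.mul_sum]
          simp
      _ ≤ Fintype.card ι + l ^ 2 / (2 * (1 - l * M / 3)) * (Fintype.card ι * σ2) := by
          gcongr
      _ = Fintype.card ι * (q + 1) := by rw [hq]; ring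
      _ ≤ Fintype.card ι * Real.exp q := by gcongr; exact Real.add_one_le_exp q
  have hsum := sum_samples_le_pow_mul (fun s => Real.exp (l * s)) f (by positivity) hstep m
  have hmk := card_filter_mul_le_sum p (fun ω : Fin m → ι => Real.exp (l * ∑ k, f (ω k)))
    (a := Real.exp (l * t)) (fun ω => (Real.exp_pos _).le)
    (fun ω hω => Real.exp_le_exp.2 (mul_le_mul_of_nonneg_left (hp ω hω).le hl0))
  have hfin := hmk.trans hsum
  have he : (Fintype.card ι * Real.exp q) ^ m * Real.exp (l * 0)
      = (Fintype.card ι : ℝ) ^ m * Real.exp (-L) * Real.exp (l * t) := by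
    rw [mul_pow, ← Real.exp_nat_mul, mul_assoc, mul_assoc, ← Real.exp_add, ← Real.exp_add]
    congr 2
    have : (m : ℝ) * q = m * σ2 * l ^ 2 / (2 * (1 - l * M / 3)) := by rw [hq]; ring
    linarith
  rw [he] at hfin
  exact le_of_mul_le_mul_right hfin (Real.exp_pos _)

/-! ### Bernstein's inequality in a Hilbert space. -/

theorem Real.hasSum_cosh_sqrt {x : ℝ} (hx : 0 ≤ x) :
    HasSum (fun k : ℕ => x ^ k / ((2 * k).factorial : ℝ)) (Real.cosh (Real.sqrt x)) := by
  have := Real.hasSum_cosh (Real.sqrt x)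
  simpa [pow_mul, Real.sq_sqrt hx] using this

/-- The power series of `cosh √x` in `x` has nonnegative coefficients, and each power is convex on
`[0, ∞)`. -/
theorem Real.convexOn_cosh_sqrt :
    ConvexOn ℝ (Set.Ici 0) fun x : ℝ => Real.cosh (Real.sqrt x) := by
  refine ⟨convex_Ici 0, fun x hx y hy a b ha hb hab => ?_⟩
  have hx : 0 ≤ x := hx
  have hy : 0 ≤ y := hy
  refine hasSum_le (fun k => ?_) (Real.hasSum_cosh_sqrt (by positivity : 0 ≤ a • x + b • y))
    (((Real.hasSum_cosh_sqrt hx).mul_left a).add ((Real.hasSum_cosh_sqrt hy).mul_left b))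
  have := (convexOn_pow k).2 hx hy ha hb hab
  simp only [smul_eq_mul] at this ⊢
  rw [mul_div_assoc', mul_div_assoc', ← add_div]
  gcongr

open RealInnerProductSpace in
-- One step of the dimension-free potential argument: the last term is linear in `w`, so it vanishes
-- on averaging over centred draws. With `p = ‖s‖`, `q = ‖w‖`, the square `‖w + s‖²` is a convex
-- combination of `(p + q)²` and `(p - q)²` whose weights depend on the cosine `c` of the angle.
-- Convexity of `cosh √·` therefore gives `cosh p cosh q + c sinh p sinh q`; splitting `sinh q = q +
-- (sinh q - q)` isolates the linear part.
theorem cosh_norm_add_le {E : Type*} [NormedAddCommGroup E] [InnerProductSpace ℝ E] (s w : E) :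
    Real.cosh ‖w + s‖ ≤ Real.cosh ‖s‖ * (Real.exp ‖w‖ - ‖w‖)
      + ⟪w, s⟫ * (Real.sinh ‖s‖ / ‖s‖) := by
  rcases eq_or_ne s 0 with rfl | hs
  · simp only [add_zero, norm_zero, Real.cosh_zero, inner_zero_right, zero_mul, one_mul]
    rw [← Real.cosh_add_sinh]
    have := Real.self_le_sinh_iff.2 (norm_nonneg w)
    linarith
  rcases eq_or_ne w 0 with rfl | hw
  · simp
  set p := ‖s‖ with hp
  set q := ‖w‖ with hq
  have hp0 : 0 < p := norm_pos_iff.2 hs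
  have hq0 : 0 < q := norm_pos_iff.2 hw
  set c := ⟪w, s⟫ / (q * p) with hc
  have hcabs : |c| ≤ 1 := abs_real_inner_div_norm_mul_norm_le_one w s
  obtain ⟨hc1, hc2⟩ := abs_le.1 hcabs
  have hin : ⟪w, s⟫ = c * (q * p) := by rw [hc]; field_simp
  have hsq : ‖w + s‖ ^ 2 = (1 + c) / 2 * (p + q) ^ 2 + (1 - c) / 2 * (p - q) ^ 2 := by
    rw [norm_add_sq_real, hin]; ring
  have hconv := Real.convexOn_cosh_sqrt.2 (sq_nonneg (p + q) : (p + q) ^ 2 ∈ Set.Ici (0 : ℝ))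
    (sq_nonneg (p - q) : (p - q) ^ 2 ∈ Set.Ici (0 : ℝ))
    (by linarith : 0 ≤ (1 + c) / 2) (by linarith : 0 ≤ (1 - c) / 2) (by ring)
  simp only [smul_eq_mul, ← hsq, Real.sqrt_sq_eq_abs, Real.cosh_abs, Real.cosh_add,
    Real.cosh_sub] at hconv
  have hsh : 0 ≤ Real.sinh q - q := by
    have := Real.self_le_sinh_iff.2 hq0.le
    linarith
  have hsp : 0 ≤ Real.sinh p := Real.sinh_nonneg_iff.2 hp0.le
  have hcs : c * Real.sinh p ≤ Real.cosh p := by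
    have := (Real.sinh_lt_cosh p).le
    nlinarith
  have h3 := mul_le_mul_of_nonneg_right hcs hsh
  have h4 : ⟪w, s⟫ * (Real.sinh p / p) = c * q * Real.sinh p := by rw [hin]; field_simp
  rw [h4, ← Real.cosh_add_sinh]
  nlinarith

open RealInnerProductSpace in
/-- Bernstein's inequality for vectors in a Hilbert space, for samples with replacement from a
finite population. -/
theorem card_bernstein_vector {ι E : Type*} [Fintype ι] [NormedAddCommGroup E]
    [InnerProductSpace ℝ E] (f : ι → E) {m : ℕ} {M σ2 L : ℝ}
    (hM : 0 ≤ M) (hL : 0 ≤ L) (hσ : 0 ≤ σ2) (h0 : ∑ j, f j = 0) (hf : ∀ j, ‖f j‖ ≤ M)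
    (h2 : ∑ j, ‖f j‖ ^ 2 ≤ Fintype.card ι * σ2)
    (p : (Fin m → ι) → Prop) [DecidablePred p]
    (hp : ∀ ω, p ω → Real.sqrt (2 * (m * σ2) * L) + M * L / 3 < ‖∑ k, f (ω k)‖) :
    ((Finset.univ.filter p).card : ℝ) ≤ (Fintype.card ι : ℝ) ^ m * (2 * Real.exp (-L)) := by
  set t := Real.sqrt (2 * (m * σ2) * L) + M * L / 3 with ht
  have ht0 : 0 ≤ t := by positivity
  rcases (show 0 ≤ m * σ2 by positivity).eq_or_lt with hV | hV
  · have hemp : Finset.univ.filter p = ∅ := by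
      refine Finset.filter_eq_empty_iff.2 fun ω _ hpω => ?_
      have := hp ω hpω
      rw [sum_sample_eq_zero f h2 hV.symm ω, norm_zero] at this
      linarith
    rw [hemp]
    simp only [Finset.card_empty, Nat.cast_zero]
    positivity
  obtain ⟨l, hl0, hl3, hl⟩ := exists_bernstein_parameter hV hM hL
  rw [← ht] at hl
  set q := σ2 * l ^ 2 / (2 * (1 - l * M / 3)) with hq
  have hden : 0 < 2 * (1 - l * M / 3) := by linarith
  have hstep : ∀ s : E, ∑ j, Real.cosh ‖l • (f j + s)‖
      ≤ (Fintype.card ι * Real.exp q) * Real.cosh ‖l • s‖ := by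
    intro s
    calc ∑ j, Real.cosh ‖l • (f j + s)‖
        ≤ ∑ j, (Real.cosh ‖l • s‖ * (1 + l ^ 2 / (2 * (1 - l * M / 3)) * ‖f j‖ ^ 2)
            + ⟪l • f j, l • s⟫ * (Real.sinh ‖l • s‖ / ‖l • s‖)) := by
          refine Finset.sum_le_sum fun j _ => ?_
          rw [smul_add]
          refine (cosh_norm_add_le _ _).trans ?_
          have hn : ‖l • f j‖ = l * ‖f j‖ := by rw [norm_smul, Real.norm_of_nonneg hl0]
          have := Real.exp_le_one_add_add_sq_div (mul_le_mul_of_nonneg_left (hf j) hl0)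
            (by positivity) hl3
          refine add_le_add_left (mul_le_mul_of_nonneg_left ?_ (Real.cosh_pos _).le) _
          rw [hn]
          have h5 : (l * ‖f j‖) ^ 2 / (2 * (1 - l * M / 3))
            = l ^ 2 / (2 * (1 - l * M / 3)) * ‖f j‖ ^ 2 := by ring
          linarith
      _ = Real.cosh ‖l • s‖ * (Fintype.card ι
            + l ^ 2 / (2 * (1 - l * M / 3)) * ∑ j, ‖f j‖ ^ 2) := by
          rw [Finset.sum_add_distrib, ← Finset.sum_mul, ← sum_inner, ← Finset.smul_sum, h0,
            ← Finset.mul_sum, Finset.sum_add_distrib, ← Finset.mul_sum]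
          simp
      _ ≤ Real.cosh ‖l • s‖ * (Fintype.card ι
            + l ^ 2 / (2 * (1 - l * M / 3)) * (Fintype.card ι * σ2)) := by
          have := (Real.cosh_pos ‖l • s‖).le
          gcongr
      _ = (Fintype.card ι * (q + 1)) * Real.cosh ‖l • s‖ := by rw [hq]; ring
      _ ≤ (Fintype.card ι * Real.exp q) * Real.cosh ‖l • s‖ := by
          have := (Real.cosh_pos ‖l • s‖).le
          gcongr
          exact Real.add_one_le_exp q
  have hsum := sum_samples_le_pow_mul (fun s : E => Real.cosh ‖l • s‖) f (by positivity) hstep m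
  have hmk := card_filter_mul_le_sum p (fun ω : Fin m → ι => Real.cosh ‖l • ∑ k, f (ω k)‖)
    -- The loss in `cosh u ≥ exp u / 2` is the factor `2` in the tail bound.
    (a := Real.exp (l * t) / 2) (fun ω => (Real.cosh_pos _).le)
    (fun ω hω => by
      have h6 : l * t ≤ ‖l • ∑ k, f (ω k)‖ := by
        rw [norm_smul, Real.norm_of_nonneg hl0]
        exact mul_le_mul_of_nonneg_left (hp ω hω).le hl0
      rw [Real.cosh_eq]
      have := Real.exp_le_exp.2 h6
      have := Real.exp_pos (-‖l • ∑ k, f (ω k)‖)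
      linarith)
  have hfin := hmk.trans hsum
  have he : (Fintype.card ι * Real.exp q) ^ m * Real.cosh ‖l • (0 : E)‖
      = (Fintype.card ι : ℝ) ^ m * (2 * Real.exp (-L)) * (Real.exp (l * t) / 2) := by
    have : Real.exp (m * q) = Real.exp (-L) * Real.exp (l * t) := by
      rw [← Real.exp_add]
      congr 1
      have : (m : ℝ) * q = m * σ2 * l ^ 2 / (2 * (1 - l * M / 3)) := by rw [hq]; ring
      linarith
    rw [mul_pow, ← Real.exp_nat_mul, this]
    simp
    ring
  rw [he] at hfin
  exact le_of_mul_le_mul_right hfin (by positivity)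

/-! ### Exponentials in a Banach algebra and the Lie–Trotter formula. -/

section BanachAlgebra

open NormedSpace Filter Topology

variable {𝔸 : Type*} [NormedRing 𝔸] [NormedAlgebra ℝ 𝔸] [CompleteSpace 𝔸]

omit [CompleteSpace 𝔸] in
theorem norm_exp_le_exp_norm [NormOneClass 𝔸] (A : 𝔸) : ‖exp A‖ ≤ Real.exp ‖A‖ := by
  rw [exp_eq_tsum ℝ]
  have h := expSeries_div_hasSum_exp (𝔸 := ℝ) ‖A‖
  rw [← Real.exp_eq_exp_ℝ] at h
  refine tsum_of_norm_bounded h fun n => ?_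
  rw [norm_smul, norm_inv, div_eq_inv_mul]
  simp only [RCLike.norm_natCast]
  gcongr
  exact norm_pow_le _ _

omit [CompleteSpace 𝔸] [NormedAlgebra ℝ 𝔸] in
-- Telescoping. The exponent `n` instead of `n - 1` costs nothing for `1 ≤ c`; in the Lie–Trotter
-- formula `c ^ n` stays bounded.
theorem norm_pow_sub_pow_le (X Y : 𝔸) {c : ℝ} (hc : 1 ≤ c) (hX : ‖X‖ ≤ c) (hY : ‖Y‖ ≤ c) (n : ℕ) :
    ‖X ^ n - Y ^ n‖ ≤ n * c ^ n * ‖X - Y‖ := by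
  have hc0 : 0 ≤ c := zero_le_one.trans hc
  induction n with
  | zero => simp
  | succ n ih =>
    rcases Nat.eq_zero_or_pos n with rfl | hn
    · simpa using le_mul_of_one_le_left (norm_nonneg (X - Y)) hc
    have hXn : ‖X ^ n‖ ≤ c ^ n := (norm_pow_le' X hn).trans (by gcongr)
    calc ‖X ^ (n + 1) - Y ^ (n + 1)‖ = ‖X ^ n * (X - Y) + (X ^ n - Y ^ n) * Y‖ := by
          congr 1; rw [pow_succ, pow_succ]; noncomm_ring
      _ ≤ ‖X ^ n‖ * ‖X - Y‖ + ‖X ^ n - Y ^ n‖ * ‖Y‖ :=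
          (norm_add_le _ _).trans (add_le_add (norm_mul_le _ _) (norm_mul_le _ _))
      _ ≤ c ^ n * ‖X - Y‖ + (n * c ^ n * ‖X - Y‖) * c := by gcongr
      _ ≤ c ^ (n + 1) * ‖X - Y‖ + (n * c ^ n * ‖X - Y‖) * c := by
          gcongr
          exact Nat.le_succ n
      _ = ((n + 1 : ℕ) : ℝ) * c ^ (n + 1) * ‖X - Y‖ := by push_cast; ring

/-- The Lie–Trotter product formula. -/
theorem tendsto_exp_mul_exp_pow [NormOneClass 𝔸] (A B : 𝔸) :
    Tendsto (fun n : ℕ => (exp ((n : ℝ)⁻¹ • A) * exp ((n : ℝ)⁻¹ • B)) ^ n) atTop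
      (𝓝 (exp (A + B))) := by
  let _ : NormedAlgebra ℚ 𝔸 := NormedAlgebra.restrictScalars ℚ ℝ 𝔸
  -- Both curves agree to first order at `0`, so their difference at `1 / n` is `o(1 / n)` and
  -- survives multiplication by `n`.
  have hd : HasDerivAt (fun t : ℝ => exp (t • A) * exp (t • B) - exp (t • (A + B))) 0 0 := by
    have h := ((hasDerivAt_exp_smul_const A (0 : ℝ)).mul
      (hasDerivAt_exp_smul_const B (0 : ℝ))).sub (hasDerivAt_exp_smul_const (A + B) (0 : ℝ))
    exact h.congr_deriv (by simp)
  have hlim : Tendsto (fun n : ℕ => (n : ℝ) * ‖exp ((n : ℝ)⁻¹ • A) * exp ((n : ℝ)⁻¹ • B)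
      - exp ((n : ℝ)⁻¹ • (A + B))‖) atTop (𝓝 0) := by
    have h1 := hd.tendsto_slope_zero_right
    have h2 : Tendsto (fun n : ℕ => (n : ℝ)⁻¹) atTop (𝓝[>] 0) :=
      tendsto_inv_atTop_nhdsGT_zero.comp tendsto_natCast_atTop_atTop
    have h3 := (h1.comp h2).norm
    simpa [Function.comp_def, norm_smul] using h3
  have hbound : ∀ᶠ n : ℕ in atTop,
      ‖(exp ((n : ℝ)⁻¹ • A) * exp ((n : ℝ)⁻¹ • B)) ^ n - exp (A + B)‖
        ≤ Real.exp (‖A‖ + ‖B‖) * ((n : ℝ) * ‖exp ((n : ℝ)⁻¹ • A) * exp ((n : ℝ)⁻¹ • B)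
      - exp ((n : ℝ)⁻¹ • (A + B))‖) := by
    filter_upwards [eventually_gt_atTop 0] with n hn
    have hn0 : (n : ℝ) ≠ 0 := by positivity
    have hpow : exp ((n : ℝ)⁻¹ • (A + B)) ^ n = exp (A + B) := by
      rw [← exp_nsmul, ← Nat.cast_smul_eq_nsmul ℝ, smul_smul, mul_inv_cancel₀ hn0, one_smul]
    have hcn : Real.exp ((n : ℝ)⁻¹ * (‖A‖ + ‖B‖)) ^ n = Real.exp (‖A‖ + ‖B‖) := by
      rw [← Real.exp_nat_mul]; congr 1; field_simp
    have hX : ‖exp ((n : ℝ)⁻¹ • A) * exp ((n : ℝ)⁻¹ • B)‖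
        ≤ Real.exp ((n : ℝ)⁻¹ * (‖A‖ + ‖B‖)) := by
      refine (norm_mul_le _ _).trans ?_
      rw [mul_add, Real.exp_add]
      have e : ∀ C : 𝔸, ‖exp ((n : ℝ)⁻¹ • C)‖ ≤ Real.exp ((n : ℝ)⁻¹ * ‖C‖) := fun C => by
        refine (norm_exp_le_exp_norm _).trans (le_of_eq ?_)
        rw [norm_smul, Real.norm_of_nonneg (by positivity)]
      exact mul_le_mul (e A) (e B) (norm_nonneg _) (Real.exp_pos _).le
    have hY : ‖exp ((n : ℝ)⁻¹ • (A + B))‖ ≤ Real.exp ((n : ℝ)⁻¹ * (‖A‖ + ‖B‖)) := by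
      refine (norm_exp_le_exp_norm _).trans (Real.exp_le_exp.2 ?_)
      rw [norm_smul, Real.norm_of_nonneg (by positivity)]
      gcongr
      exact norm_add_le _ _
    have := norm_pow_sub_pow_le _ _ (Real.one_le_exp (by positivity)) hX hY n
    rw [hpow, hcn] at this
    refine this.trans (le_of_eq (by ring))
  rw [tendsto_iff_norm_sub_tendsto_zero]
  refine squeeze_zero' (Eventually.of_forall fun _ => norm_nonneg _) hbound ?_
  simpa using hlim.const_mul (Real.exp (‖A‖ + ‖B‖))

/-- The exponential of a multiple of a scaled idempotent. -/
theorem exp_smul_of_mul_self_eq_smul (P : 𝔸) {q : ℝ} (hq : q ≠ 0) (hP : P * P = q • P) (t : ℝ) :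
    exp (t • P) = 1 + ((Real.exp (t * q) - 1) / q) • P := by
  have hpow : ∀ n : ℕ, P ^ (n + 1) = q ^ n • P := by
    intro n
    induction n with
    | zero => simp
    | succ n ih => rw [pow_succ, ih, smul_mul_assoc, hP, smul_smul, pow_succ]
  have h1 : HasSum (fun n : ℕ => ((n + 1).factorial : ℝ)⁻¹ • (t • P) ^ (n + 1))
      (exp (t • P) - 1) := by
    have := (hasSum_nat_add_iff' 1).2 (exp_series_hasSum_exp' (𝕂 := ℝ) (t • P))
    simpa using this
  have h2 : HasSum (fun n : ℕ => (t * q) ^ (n + 1) / ((n + 1).factorial : ℝ))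
      (Real.exp (t * q) - 1) := by
    have h0 := expSeries_div_hasSum_exp (𝔸 := ℝ) (t * q)
    rw [← Real.exp_eq_exp_ℝ] at h0
    have := (hasSum_nat_add_iff' 1).2 h0
    simpa using this
  have h3 := ((h2.div_const q).smul_const P)
  have h4 : (fun n : ℕ => ((t * q) ^ (n + 1) / ((n + 1).factorial : ℝ) / q) • P)
      = fun n : ℕ => ((n + 1).factorial : ℝ)⁻¹ • (t • P) ^ (n + 1) := by
    funext n
    rw [smul_pow, hpow, smul_smul, smul_smul]
    congr 1
    rw [mul_pow, pow_succ q]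
    field_simp
  rw [h4] at h3
  rw [← h1.unique h3]
  abel

end BanachAlgebra

/-! ### The Golden–Thompson inequality for real symmetric matrices. -/

namespace Matrix

open NormedSpace Filter Topology

variable {κ : Type*} [Fintype κ] [DecidableEq κ]

theorem tendsto_exp_mul_exp_pow [Nonempty κ] (A B : Matrix κ κ ℝ) :
    Tendsto (fun n : ℕ => (exp ((n : ℝ)⁻¹ • A) * exp ((n : ℝ)⁻¹ • B)) ^ n) atTop
      (𝓝 (exp (A + B))) := by
  open scoped Matrix.Norms.Operator in exact _root_.tendsto_exp_mul_exp_pow A B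

theorem exp_smul_of_mul_self_eq_smul (P : Matrix κ κ ℝ) {q : ℝ} (hq : q ≠ 0) (hP : P * P = q • P)
    (t : ℝ) : exp (t • P) = 1 + ((Real.exp (t * q) - 1) / q) • P := by
  open scoped Matrix.Norms.Operator in exact _root_.exp_smul_of_mul_self_eq_smul P hq hP t

theorem trace_mul_pow_comm (A B : Matrix κ κ ℝ) (n : ℕ) :
    trace ((A * B) ^ n) = trace ((B * A) ^ n) := by
  cases n with
  | zero => simp
  | succ n =>
    rw [pow_succ (A * B), ← mul_assoc, mul_pow_mul, mul_assoc, trace_mul_comm, mul_assoc, ← pow_succ]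

omit [DecidableEq κ] in
theorem two_mul_trace_mul_le (P Q : Matrix κ κ ℝ) :
    2 * trace (P * Q) ≤ trace (P * Pᵀ) + trace (Qᵀ * Q) := by
  have h := (posSemidef_conjTranspose_mul_self (Pᵀ - Q)).trace_nonneg
  simp only [conjTranspose_eq_transpose_of_trivial, transpose_sub, transpose_transpose, sub_mul,
    mul_sub, trace_sub] at h
  have : trace (Qᵀ * Pᵀ) = trace (P * Q) := by rw [← transpose_mul, trace_transpose]
  linarith

/-- The two claims feed each other, hence the joint induction. For the first, apply it to `X ^ 2`,
rotate the trace to reach `(Xᵀ * X) * (X * Xᵀ)`, use the second claim, and finish with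
`two_mul_trace_mul_le`. For the second, apply the first to `P * Q` and rotate to `P ^ 2 * Q ^ 2`. No
positivity of `P` or `Q` is needed. -/
theorem trace_pow_two_pow_le (k : ℕ) :
    (∀ X : Matrix κ κ ℝ, trace (X ^ (2 * 2 ^ k)) ≤ trace ((Xᵀ * X) ^ 2 ^ k)) ∧
      ∀ P Q : Matrix κ κ ℝ, P.IsSymm → Q.IsSymm →
        trace ((P * Q) ^ 2 ^ k) ≤ trace (P ^ 2 ^ k * Q ^ 2 ^ k) := by
  induction k with
  | zero =>
    refine ⟨fun X => ?_, fun P Q _ _ => by simp⟩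
    have := two_mul_trace_mul_le X X
    rw [trace_mul_comm X Xᵀ] at this
    simp only [pow_zero, mul_one, pow_one, pow_two]
    linarith
  | succ k ih =>
    obtain ⟨h1, h2⟩ := ih
    have hk : 2 ^ (k + 1) = 2 * 2 ^ k := by ring
    refine ⟨fun X => ?_, fun P Q hP hQ => ?_⟩
    · have hs1 : (Xᵀ * X).IsSymm := isSymm_transpose_mul_self X
      have hs2 : (X * Xᵀ).IsSymm := isSymm_mul_transpose_self X
      have a1 := h1 (X ^ 2)
      have a2 : trace (((X ^ 2)ᵀ * X ^ 2) ^ 2 ^ k) = trace (((Xᵀ * X) * (X * Xᵀ)) ^ 2 ^ k) := by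
        rw [pow_two, transpose_mul, mul_assoc, trace_mul_pow_comm]
        simp only [mul_assoc]
      have a3 := h2 _ _ hs1 hs2
      have a4 := two_mul_trace_mul_le ((Xᵀ * X) ^ 2 ^ k) ((X * Xᵀ) ^ 2 ^ k)
      rw [(hs1.pow _).eq, (hs2.pow _).eq, ← pow_add, ← pow_add, ← two_mul, ← hk,
        trace_mul_pow_comm X Xᵀ] at a4
      rw [← pow_mul, ← hk] at a1
      rw [hk] at a1 ⊢
      rw [hk] at a4
      linarith
    · have a1 := h1 (P * Q)
      have a2 : trace (((P * Q)ᵀ * (P * Q)) ^ 2 ^ k) = trace ((P ^ 2 * Q ^ 2) ^ 2 ^ k) := by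
        rw [transpose_mul, hP.eq, hQ.eq, pow_two, pow_two, mul_assoc, trace_mul_pow_comm]
        simp only [mul_assoc]
      have a3 := h2 _ _ (hP.pow 2) (hQ.pow 2)
      rw [← pow_mul, ← pow_mul] at a3
      rw [hk]
      linarith

/-- The Golden–Thompson inequality. -/
theorem trace_exp_add_le {A B : Matrix κ κ ℝ} (hA : A.IsSymm) (hB : B.IsSymm) :
    trace (exp (A + B)) ≤ trace (exp A * exp B) := by
  rcases isEmpty_or_nonempty κ with h | h
  · simp [trace]
  have hlim : Tendsto (fun k : ℕ => trace ((exp (((2 ^ k : ℕ) : ℝ)⁻¹ • A)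
      * exp (((2 ^ k : ℕ) : ℝ)⁻¹ • B)) ^ 2 ^ k)) atTop (𝓝 (trace (exp (A + B)))) :=
    ((continuous_id.matrix_trace.tendsto (exp (A + B))).comp (tendsto_exp_mul_exp_pow A B)).comp
      (tendsto_pow_atTop_atTop_of_one_lt one_lt_two)
  refine le_of_tendsto' hlim fun k => ?_
  have e : ∀ C : Matrix κ κ ℝ, exp (((2 ^ k : ℕ) : ℝ)⁻¹ • C) ^ 2 ^ k = exp C := fun C => by
    rw [← Matrix.exp_nsmul, ← Nat.cast_smul_eq_nsmul ℝ, smul_smul,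
      mul_inv_cancel₀ (by positivity), one_smul]
  have := (trace_pow_two_pow_le k).2 (exp (((2 ^ k : ℕ) : ℝ)⁻¹ • A))
    (exp (((2 ^ k : ℕ) : ℝ)⁻¹ • B)) (hA.smul _).exp (hB.smul _).exp
  rwa [e, e] at this

end Matrix

/-! ### Traces of matrix exponentials and the matrix Chernoff bound. -/

namespace Matrix

open NormedSpace

variable {κ : Type*} [Fintype κ] [DecidableEq κ]

theorem trace_exp_smul_eq_sum {A : Matrix κ κ ℝ} (hA : A.IsHermitian) (c : ℝ) :
    trace (exp (c • A)) = ∑ i, Real.exp (c * hA.eigenvalues i) := by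
  set W := (hA.eigenvectorUnitary : Matrix κ κ ℝ) with hW
  have hu : IsUnit W := ⟨Unitary.toUnits hA.eigenvectorUnitary, rfl⟩
  have hinv : star W = W⁻¹ := by
    refine (Matrix.inv_eq_left_inv ?_).symm
    exact Unitary.coe_star_mul_self hA.eigenvectorUnitary
  have hsp : A = W * diagonal hA.eigenvalues * W⁻¹ := by
    conv_lhs => rw [hA.spectral_theorem, Unitary.conjStarAlgAut_apply]
    rw [← hinv]
    rfl
  have h1 : c • A = W * diagonal (c • hA.eigenvalues) * W⁻¹ := by
    conv_lhs => rw [hsp]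
    rw [diagonal_smul, Matrix.mul_smul, Matrix.smul_mul]
  rw [h1, Matrix.exp_conj _ _ hu, trace_mul_comm, ← mul_assoc,
    nonsing_inv_mul _ ((isUnit_iff_isUnit_det _).1 hu), one_mul, exp_diagonal, trace_diagonal]
  refine Finset.sum_congr rfl fun i _ => ?_
  rw [Pi.coe_exp, Real.exp_eq_exp_ℝ]
  rfl

/-- The trace of the exponential detects small values of the quadratic form. -/
theorem exp_neg_le_trace_exp {A : Matrix κ κ ℝ} (hA : A.IsSymm) {a t : ℝ} (ht : 0 ≤ t)
    (v : κ → ℝ) (hv : v ≠ 0) (h : v ⬝ᵥ A *ᵥ v ≤ a * (v ⬝ᵥ v)) :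
    Real.exp (-t * a) ≤ trace (exp (-t • A)) := by
  have hH : (A - a • (1 : Matrix κ κ ℝ)).IsHermitian := by
    rw [IsHermitian, conjTranspose_eq_transpose_of_trivial]
    simp [hA.eq]
  -- The vector `v` forces a nonpositive eigenvalue of `A - a`, which alone contributes at least `1`
  -- to the trace of `exp (-t • (A - a • 1))`.
  have hnot : ¬ (A - a • (1 : Matrix κ κ ℝ)).PosDef := by
    intro hpd
    have := hpd.dotProduct_mulVec_pos hv
    simp only [star_trivial, sub_mulVec, smul_mulVec, one_mulVec, dotProduct_sub,
      dotProduct_smul, smul_eq_mul] at this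
    linarith
  rw [hH.posDef_iff_eigenvalues_pos] at hnot
  push Not at hnot
  obtain ⟨i, hi⟩ := hnot
  have hcomm : Commute (-t • (A - a • (1 : Matrix κ κ ℝ))) ((-t * a) • (1 : Matrix κ κ ℝ)) :=
    (Commute.one_right _).smul_right _
  have hsplit : -t • A = -t • (A - a • (1 : Matrix κ κ ℝ)) + (-t * a) • (1 : Matrix κ κ ℝ) := by
    rw [smul_sub, smul_smul]; abel
  have hone : exp ((-t * a) • (1 : Matrix κ κ ℝ)) = Real.exp (-t * a) • 1 := by
    rw [exp_smul_of_mul_self_eq_smul 1 one_ne_zero (by simp)]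
    rw [mul_one, div_one, sub_smul, one_smul]; abel
  rw [hsplit, Matrix.exp_add_of_commute _ _ hcomm, hone, Matrix.mul_smul, mul_one, trace_smul,
    trace_exp_smul_eq_sum hH, smul_eq_mul]
  refine le_mul_of_one_le_right (Real.exp_pos _).le ?_
  refine le_trans ?_ (Finset.single_le_sum (fun i _ => (Real.exp_pos _).le) (Finset.mem_univ i))
  refine Real.one_le_exp ?_
  nlinarith

/-- The exponential of a rank-one matrix is affine in it, with coefficient `(exp (-t q) - 1) / q`
for `q = x ⬝ᵥ x`. The quadratic bound for `exp` at nonpositive arguments makes this at most `-t + t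
^ 2 * R / 2`, and the trace it multiplies is nonnegative. -/
theorem trace_exp_rankOne_mul_le (x : κ → ℝ) {R t : ℝ} (hR : x ⬝ᵥ x ≤ R) (ht : 0 ≤ t)
    {E : Matrix κ κ ℝ} (hE : E.PosSemidef) :
    trace (exp (-t • vecMulVec x x) * E)
      ≤ trace E - (t - t ^ 2 * R / 2) * trace (vecMulVec x x * E) := by
  have hnn : 0 ≤ trace (vecMulVec x x * E) := by
    rw [vecMulVec_mul, trace_vecMulVec, dotProduct_comm, ← dotProduct_mulVec]
    simpa using hE.dotProduct_mulVec_nonneg x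
  rcases eq_or_ne (x ⬝ᵥ x) 0 with hq | hq
  · have hx : x = 0 := dotProduct_self_eq_zero.1 hq
    subst hx
    simp
  · have hq0 : 0 < x ⬝ᵥ x :=
      lt_of_le_of_ne (Finset.sum_nonneg fun i _ => mul_self_nonneg (x i)) hq.symm
    set q := x ⬝ᵥ x with hqdef
    have hP : vecMulVec x x * vecMulVec x x = q • vecMulVec x x := by
      rw [vecMulVec_mul_vecMulVec, ← hqdef]
      ext i j
      simp [vecMulVec_apply]
      ring
    rw [exp_smul_of_mul_self_eq_smul _ hq hP, add_mul, one_mul, Matrix.smul_mul, trace_add,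
      trace_smul, smul_eq_mul, sub_eq_add_neg (trace E), ← neg_mul]
    gcongr
    rw [div_le_iff₀ hq0]
    have h1 := Real.exp_le_one_add_add_sq_div_two_of_nonpos (x := -t * q) (by nlinarith)
    have h2 : t ^ 2 * q * q ≤ t ^ 2 * R * q := by gcongr
    nlinarith

theorem posSemidef_exp {A : Matrix κ κ ℝ} (hA : A.IsSymm) : (exp A).PosSemidef := by
  have h : exp A = (exp ((2 : ℝ)⁻¹ • A))ᴴ * exp ((2 : ℝ)⁻¹ • A) := by
    rw [conjTranspose_eq_transpose_of_trivial, (hA.smul _).exp.eq,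
      ← Matrix.exp_add_of_commute _ _ (Commute.refl _), ← add_smul]
    norm_num
  rw [h]
  exact posSemidef_conjTranspose_mul_self _

end Matrix

open NormedSpace Matrix in
/-- The lower matrix Chernoff bound for samples with replacement from an isotropic finite family of
vectors. -/
theorem card_matrix_chernoff {ι κ : Type*} [Fintype ι] [Nonempty ι] [Fintype κ] [DecidableEq κ]
    (x : ι → κ → ℝ)
    (hx : ∑ j, vecMulVec (x j) (x j) = 1) {R : ℝ} (hR0 : 0 < R) (hR : ∀ j, x j ⬝ᵥ x j ≤ R)
    {m : ℕ} {ε : ℝ} (hε : 0 ≤ ε) (p : (Fin m → ι) → Prop) [DecidablePred p]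
    (hp : ∀ ω, p ω → ∃ v ≠ 0,
      ∑ k, (x (ω k) ⬝ᵥ v) ^ 2 ≤ (1 - ε) * (m / Fintype.card ι) * (v ⬝ᵥ v)) :
    ((Finset.univ.filter p).card : ℝ) ≤ (Fintype.card ι : ℝ) ^ m
      * (Fintype.card κ * Real.exp (-(ε ^ 2 * m / (2 * (Fintype.card ι * R))))) := by
  set N := (Fintype.card ι : ℝ) with hN
  have hN0 : 0 < N := by rw [hN]; exact_mod_cast Fintype.card_pos
  have hsym : ∀ j, IsSelfAdjoint (vecMulVec (x j) (x j)) := fun j => by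
    rw [IsSelfAdjoint, star_eq_conjTranspose]
    ext a b
    simp [vecMulVec_apply, mul_comm]
  -- The partial sums live in the self-adjoint matrices because the one-step bound must hold for
  -- every `s`, and Golden–Thompson needs symmetry.
  set f : ι → selfAdjoint (Matrix κ κ ℝ) := fun j => ⟨vecMulVec (x j) (x j), hsym j⟩ with hf
  have hS : ∀ s : selfAdjoint (Matrix κ κ ℝ), (s : Matrix κ κ ℝ).IsSymm := fun s => by
    have : star (s : Matrix κ κ ℝ) = s := s.2
    rwa [star_eq_conjTranspose, conjTranspose_eq_transpose_of_trivial] at this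
  -- Minimizer of the final exponent `(m / N) * (t ^ 2 * R / 2 - t * ε)`.
  set t := ε / R with ht
  have ht0 : 0 ≤ t := by positivity
  set c := t - t ^ 2 * R / 2 with hc
  set Ψ : selfAdjoint (Matrix κ κ ℝ) → ℝ := fun s => trace (exp (-t • (s : Matrix κ κ ℝ))) with hΨ
  have hpsd : ∀ s : selfAdjoint (Matrix κ κ ℝ), (exp (-t • (s : Matrix κ κ ℝ))).PosSemidef :=
    fun s => posSemidef_exp ((hS s).smul _)
  have hstep : ∀ s, ∑ j, Ψ (f j + s) ≤ (N * Real.exp (-(c / N))) * Ψ s := by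
    intro s
    calc ∑ j, Ψ (f j + s)
        ≤ ∑ j, (Ψ s - c * trace (vecMulVec (x j) (x j) * exp (-t • (s : Matrix κ κ ℝ)))) := by
          refine Finset.sum_le_sum fun j _ => ?_
          have h1 : Ψ (f j + s)
              = trace (exp (-t • vecMulVec (x j) (x j) + -t • (s : Matrix κ κ ℝ))) := by
            rw [← smul_add]; rfl
          rw [h1]
          exact (trace_exp_add_le ((hS (f j)).smul _) ((hS s).smul _)).trans
            (trace_exp_rankOne_mul_le _ (hR j) ht0 (hpsd s))
      _ = (N - c) * Ψ s := by
          have hE : ∑ j, trace (vecMulVec (x j) (x j) * exp (-t • (s : Matrix κ κ ℝ))) = Ψ s := by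
            rw [← trace_sum, ← Finset.sum_mul, hx, one_mul]
          rw [Finset.sum_sub_distrib, ← Finset.mul_sum, hE]
          simp only [Finset.sum_const, Finset.card_univ, nsmul_eq_mul, ← hN]
          ring
      _ ≤ (N * Real.exp (-(c / N))) * Ψ s := by
          refine mul_le_mul_of_nonneg_right ?_ (hpsd s).trace_nonneg
          have := mul_le_mul_of_nonneg_left (Real.add_one_le_exp (-(c / N))) hN0.le
          have e : N * (-(c / N) + 1) = N - c := by field_simp; ring
          linarith
  have hsum := sum_samples_le_pow_mul Ψ f (by positivity) hstep m
  have hmk := card_filter_mul_le_sum p (fun ω : Fin m → ι => Ψ (∑ k, f (ω k)))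
    (a := Real.exp (-t * ((1 - ε) * (m / N)))) (fun ω => (hpsd _).trace_nonneg)
    (fun ω hω => by
      obtain ⟨v, hv0, hv⟩ := hp ω hω
      refine exp_neg_le_trace_exp (hS _) ht0 v hv0 ?_
      refine le_trans (le_of_eq ?_) hv
      rw [AddSubgroup.val_finsetSum, sum_mulVec, dotProduct_sum]
      refine Finset.sum_congr rfl fun k _ => ?_
      simp only [hf]
      rw [vecMulVec_mulVec]
      simp [dotProduct_comm, pow_two])
  have hfin := hmk.trans hsum
  have h0 : Ψ 0 = Fintype.card κ := by simp [hΨ]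
  have he : (N * Real.exp (-(c / N))) ^ m * Ψ 0
      = N ^ m * (Fintype.card κ * Real.exp (-(ε ^ 2 * m / (2 * (N * R)))))
        * Real.exp (-t * ((1 - ε) * (m / N))) := by
    rw [h0, mul_pow, ← Real.exp_nat_mul]
    have : Real.exp (m * -(c / N)) = Real.exp (-(ε ^ 2 * m / (2 * (N * R))))
        * Real.exp (-t * ((1 - ε) * (m / N))) := by
      rw [← Real.exp_add]
      congr 1
      rw [hc, ht]
      field_simp
      ring
    rw [this]
    ring
  rw [he] at hfin
  exact le_of_mul_le_mul_right hfin (Real.exp_pos _)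

/-! ### Tensor algebra through frontal slices in the transform domain. -/

section TensorAlgebra

variable {n n₁ n₂ n₃ n₄ n₅ : ℕ}

theorem DiscreteTransform.transform_injective (L : DiscreteTransform n) :
    Function.Injective L.transform := by
  intro a b h
  have hinj : Function.Injective (fun u : Fin n → ℂ => L.M *ᵥ u) :=
    Matrix.mulVec_injective_of_isUnit ((Matrix.isUnit_iff_isUnit_det _).2 L.isUnit_det)
  funext j
  exact_mod_cast congrFun (hinj h) j

theorem DiscreteTransform.transform_sum (L : DiscreteTransform n) {ι : Type*} (s : Finset ι)
    (f : ι → Fin n → ℝ) : L.transform (∑ i ∈ s, f i) = ∑ i ∈ s, L.transform (f i) := by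
  simp only [DiscreteTransform.transform]
  rw [← Matrix.mulVec_sum]
  congr 1
  funext j
  simp

theorem DiscreteTransform.transform_zero (L : DiscreteTransform n) : L.transform 0 = 0 := by
  simpa using L.transform_sum (∅ : Finset Unit) fun _ => 0

/-- The frontal slices of a tensor in the transform domain. -/
noncomputable def transformSlice (L : DiscreteTransform n₃) (A : Tensor n₁ n₂ n₃) (k : Fin n₃) :
    Matrix (Fin n₁) (Fin n₂) ℂ :=
  Matrix.of fun i j => L.transform (A i j) k

theorem eq_of_transformSlice_eq (L : DiscreteTransform n₃) {A B : Tensor n₁ n₂ n₃}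
    (h : ∀ k, transformSlice L A k = transformSlice L B k) : A = B := by
  funext i j
  refine L.transform_injective (funext fun k => ?_)
  exact congrFun (congrFun (h k) i) j

/-- Slicewise the `L`-product is the matrix product, so algebraic identities for tensors reduce to
identities for complex matrices. -/
theorem transformSlice_tensorMul (L : DiscreteTransform n₃) (A : Tensor n₁ n₂ n₃)
    (B : Tensor n₂ n₄ n₃) (k : Fin n₃) :
    transformSlice L (tensorMul L A B) k = transformSlice L A k * transformSlice L B k := by
  ext i j
  simp [transformSlice, tensorMul, Matrix.mul_apply, L.transform_sum, transform_tubeMul]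

theorem transformSlice_tensorId (L : DiscreteTransform n₃) (d : ℕ) (k : Fin n₃) :
    transformSlice L (tensorId L d) k = 1 := by
  ext i j
  rcases eq_or_ne i j with rfl | h
  · simp [transformSlice, tensorId, transform_tubeOne]
  · simp [transformSlice, tensorId, h, L.transform_zero]

theorem tensorMul_assoc (L : DiscreteTransform n₃) (A : Tensor n₁ n₂ n₃) (B : Tensor n₂ n₄ n₃)
    (C : Tensor n₄ n₅ n₃) :
    tensorMul L (tensorMul L A B) C = tensorMul L A (tensorMul L B C) :=
  eq_of_transformSlice_eq L fun k => by simp only [transformSlice_tensorMul, Matrix.mul_assoc]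

theorem tensorId_tensorMul (L : DiscreteTransform n₃) (A : Tensor n₁ n₂ n₃) :
    tensorMul L (tensorId L n₁) A = A :=
  eq_of_transformSlice_eq L fun k => by
    rw [transformSlice_tensorMul, transformSlice_tensorId, Matrix.one_mul]

theorem tubeMul_zero (L : DiscreteTransform n) (a : Fin n → ℝ) : tubeMul L a 0 = 0 :=
  L.transform_injective (by rw [transform_tubeMul, L.transform_zero]; funext k; simp)

theorem tubeMul_tubeOne (L : DiscreteTransform n) (a : Fin n → ℝ) : tubeMul L a (tubeOne L) = a :=
  L.transform_injective (by rw [transform_tubeMul, transform_tubeOne]; funext k; simp)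

theorem tensorMul_zero (L : DiscreteTransform n₃) (A : Tensor n₁ n₂ n₃) :
    tensorMul L A (0 : Tensor n₂ n₄ n₃) = 0 := by
  funext i j
  exact Finset.sum_eq_zero fun s _ => tubeMul_zero L _

theorem tensorMul_add (L : DiscreteTransform n₃) (A : Tensor n₁ n₂ n₃) (B C : Tensor n₂ n₄ n₃) :
    tensorMul L A (B + C) = tensorMul L A B + tensorMul L A C := by
  have h : ∀ (D E : Tensor n₂ n₄ n₃) k,
      transformSlice L (D + E) k = transformSlice L D k + transformSlice L E k := fun D E k => by
    ext i j
    have := congrFun (L.transform_sum Finset.univ ![D i j, E i j]) k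
    simpa [transformSlice, Fin.sum_univ_two] using this
  have h' : ∀ (D E : Tensor n₁ n₄ n₃) k,
      transformSlice L (D + E) k = transformSlice L D k + transformSlice L E k := fun D E k => by
    ext i j
    have := congrFun (L.transform_sum Finset.univ ![D i j, E i j]) k
    simpa [transformSlice, Fin.sum_univ_two] using this
  exact eq_of_transformSlice_eq L fun k => by
    rw [transformSlice_tensorMul, h, h', Matrix.mul_add, transformSlice_tensorMul,
      transformSlice_tensorMul]

theorem exists_eq_tensorMul_of_mem_tensorColumnSpace (L : DiscreteTransform n₃)
    {U : Tensor n₁ n₂ n₃} {X : Tensor n₁ 1 n₃} (hX : X ∈ tensorColumnSpace L U) :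
    ∃ C : Tensor n₂ 1 n₃, X = tensorMul L U C := by
  obtain ⟨c, rfl⟩ := hX
  exact ⟨fun s _ => c s, rfl⟩

/-- Each tensor column of `U` lies in the column space (take the unit tube as its coefficient), so
its pairing with `Y` vanishes. -/
theorem tensorTranspose_mul_eq_zero (L : DiscreteTransform n₃) {U : Tensor n₁ n₂ n₃}
    {Y : Tensor n₁ 1 n₃} (hY : Y ∈ tensorOrthogonal L (tensorColumnSpace L U)) :
    tensorMul L (tensorTranspose L U) Y = 0 := by
  funext j i
  have hZ : (fun i _ => U i j : Tensor n₁ 1 n₃) ∈ tensorColumnSpace L U := by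
    refine ⟨fun s => if s = j then tubeOne L else 0, ?_⟩
    funext i _
    rw [Finset.sum_eq_single j]
    · simp [tubeMul_tubeOne]
    · intro s _ hs
      simp [hs, tubeMul_zero]
    · simp
  exact congrFun (congrFun (hY _ hZ) 0) i

theorem sub_tensorMul_projection_eq (L : DiscreteTransform n₃) {U : Tensor n₁ n₂ n₃}
    {G : Tensor n₂ n₂ n₃} (hG : IsTensorInverse L (tensorMul L (tensorTranspose L U) U) G)
    {X Y : Tensor n₁ 1 n₃} (hX : X ∈ tensorColumnSpace L U)
    (hY : Y ∈ tensorOrthogonal L (tensorColumnSpace L U)) :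
    X + Y - tensorMul L (tensorMul L (tensorMul L U G) (tensorTranspose L U)) (X + Y) = Y := by
  obtain ⟨C, rfl⟩ := exists_eq_tensorMul_of_mem_tensorColumnSpace L hX
  rw [tensorMul_add]
  have h1 : tensorMul L (tensorMul L (tensorMul L U G) (tensorTranspose L U)) Y = 0 := by
    rw [tensorMul_assoc, tensorTranspose_mul_eq_zero L hY, tensorMul_zero]
  have h2 : tensorMul L (tensorMul L (tensorMul L U G) (tensorTranspose L U)) (tensorMul L U C)
      = tensorMul L U C := by
    rw [tensorMul_assoc, ← tensorMul_assoc L (tensorTranspose L U), tensorMul_assoc L U,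
      ← tensorMul_assoc L G, hG.2, tensorId_tensorMul]
  rw [h1, h2]
  abel

theorem frobNorm_sq_eq (Y : Tensor n₁ 1 n₃) : frobNorm Y ^ 2 = ‖unfold Y‖ ^ 2 := by
  rw [frobNorm, Real.sq_sqrt (by positivity), EuclideanSpace.norm_sq_eq, Fintype.sum_prod_type]
  simp [unfold]

/-- `G • U†` is a left inverse of `U`, and every vector is the unfolding of some tensor column. -/
theorem lmat_mulVec_injective (L : DiscreteTransform n₃) {U : Tensor n₁ n₂ n₃}
    {G : Tensor n₂ n₂ n₃} (hG : IsTensorInverse L (tensorMul L (tensorTranspose L U) U) G) :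
    Function.Injective (lmat L U).mulVec := by
  rw [← Matrix.coe_mulVecLin, injective_iff_map_eq_zero]
  intro c hc
  rw [Matrix.mulVecLin_apply] at hc
  set C : Tensor n₂ 1 n₃ := fun s _ l => c (s, l) with hC
  have hcC : c = (unfold C).ofLp := rfl
  have h1 : tensorMul L U C = 0 := by
    have h := unfold_tensorMul L U C
    rw [← hcC, hc] at h
    funext i j k
    have h' := congrArg (fun z => z (i, k)) h
    rw [Subsingleton.elim j 0]
    simpa [unfold] using h'
  have h2 : C = 0 := by
    have : C = tensorMul L (tensorMul L G (tensorMul L (tensorTranspose L U) U)) C := by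
      rw [hG.2, tensorId_tensorMul]
    rw [this, tensorMul_assoc, tensorMul_assoc, h1, tensorMul_zero, tensorMul_zero]
  rw [hcC, h2]
  rfl

theorem mem_vectorSubspace_iff (L : DiscreteTransform n₃) (U : Tensor n₁ n₂ n₃)
    (s : EuclideanSpace ℝ (Fin n₁ × Fin n₃)) :
    s ∈ vectorSubspace L U ↔ ∃ c, s = WithLp.toLp 2 (lmat L U *ᵥ c) := by
  rw [vectorSubspace, Submodule.mem_span_range_iff_exists_fun]
  refine exists_congr fun c => ?_
  rw [eq_comm]
  refine Eq.congr_right ?_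
  ext p
  simp [Matrix.mulVec, dotProduct, mul_comm]

theorem unfold_mem_vectorSubspace (L : DiscreteTransform n₃) {U : Tensor n₁ n₂ n₃}
    {X : Tensor n₁ 1 n₃} (hX : X ∈ tensorColumnSpace L U) :
    unfold X ∈ vectorSubspace L U := by
  obtain ⟨C, rfl⟩ := exists_eq_tensorMul_of_mem_tensorColumnSpace L hX
  exact (mem_vectorSubspace_iff L U _).2 ⟨_, unfold_tensorMul L U C⟩

end TensorAlgebra

/-! ### Least squares on the sample. -/

section Residual

variable {n₁ n₃ m : ℕ} {κ : Type} [Fintype κ] [DecidableEq κ]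

theorem isUnit_transpose_mul_self {a b : Type*} [Fintype a] [Fintype b] [DecidableEq b]
    (B : Matrix a b ℝ) (hB : ∀ c, B *ᵥ c = 0 → c = 0) : IsUnit (Bᵀ * B) := by
  rw [← Matrix.mulVec_injective_iff_isUnit, ← Matrix.coe_mulVecLin, injective_iff_map_eq_zero]
  intro c hc
  refine hB c ?_
  rw [Matrix.mulVecLin_apply, ← Matrix.conjTranspose_eq_transpose_of_trivial] at hc
  exact (Matrix.conjTranspose_mul_self_mulVec_eq_zero _ _).1 hc

/-- The residual of `x + y` with `x = A c` in the column space is that of a least squares fit of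
`y`. -/
theorem exists_residualEnergy_eq (Ω : Fin m → Fin n₁ × Fin n₃)
    (A : Matrix (Fin n₁ × Fin n₃) κ ℝ)
    (hu : IsUnit ((sampleMat Ω A)ᵀ * sampleMat Ω A)) (y : EuclideanSpace ℝ (Fin n₁ × Fin n₃))
    (c : κ → ℝ) :
    (∃ c', residualEnergy Ω A (WithLp.toLp 2 (A *ᵥ c) + y)
      = ∑ k, (y (Ω k) - (A *ᵥ c') (Ω k)) ^ 2) ∧
    residualEnergy Ω A (WithLp.toLp 2 (A *ᵥ c) + y) ≤ ∑ k, y (Ω k) ^ 2 := by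
  set B := sampleMat Ω A with hB
  set t := WithLp.toLp 2 (A *ᵥ c) + y with ht
  set d := (Bᵀ * B)⁻¹ *ᵥ (Bᵀ *ᵥ sampleVec Ω t) with hd
  have hBv : ∀ e k, (B *ᵥ e) k = (A *ᵥ e) (Ω k) := fun e k => rfl
  have hproj : sampleProj Ω A *ᵥ sampleVec Ω t = B *ᵥ d := by
    rw [hd, sampleProj, ← hB]
    simp only [Matrix.mulVec_mulVec, Matrix.mul_assoc]
  have hr : ∀ k, sampleVec Ω t k - (sampleProj Ω A *ᵥ sampleVec Ω t) k
      = y (Ω k) - (A *ᵥ (d - c)) (Ω k) := fun k => by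
    rw [hproj, hBv, Matrix.mulVec_sub, sampleVec, ht]
    simp only [PiLp.add_apply, Pi.sub_apply]
    ring
  have hE : residualEnergy Ω A t = ∑ k, (y (Ω k) - (A *ᵥ (d - c)) (Ω k)) ^ 2 :=
    Finset.sum_congr rfl fun k _ => by rw [hr]
  refine ⟨⟨d - c, hE⟩, ?_⟩
  rw [hE]
  set r : Fin m → ℝ := fun k => y (Ω k) - (A *ᵥ (d - c)) (Ω k) with hrdef
  have hr' : r = sampleVec Ω t - B *ᵥ d := by
    funext k
    rw [Pi.sub_apply, ← hproj, hr]
  -- The normal equations: the residual is orthogonal to the sampled column space, so the sampled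
  -- energy of `y` splits by Pythagoras.
  have horth : Bᵀ *ᵥ r = 0 := by
    rw [hr', Matrix.mulVec_sub, hd, Matrix.mulVec_mulVec _ Bᵀ B, Matrix.mulVec_mulVec,
      Matrix.mul_nonsing_inv _ ((Matrix.isUnit_iff_isUnit_det _).1 hu), Matrix.one_mulVec, sub_self]
  have hcross : ∑ k, r k * (A *ᵥ (d - c)) (Ω k) = 0 := by
    have : r ⬝ᵥ B *ᵥ (d - c) = 0 := by
      rw [Matrix.dotProduct_mulVec, ← Matrix.mulVec_transpose, horth, zero_dotProduct]
    exact this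
  have hy : ∀ k, y (Ω k) ^ 2 = r k ^ 2 + 2 * (r k * (A *ᵥ (d - c)) (Ω k))
      + (A *ᵥ (d - c)) (Ω k) ^ 2 := fun k => by
    simp only [hrdef]
    ring
  simp only [hy, Finset.sum_add_distrib, ← Finset.mul_sum, hcross]
  have : 0 ≤ ∑ k, (A *ᵥ (d - c)) (Ω k) ^ 2 := by positivity
  change ∑ k, r k ^ 2 ≤ _
  linarith

open RealInnerProductSpace in
/-- A lower bound for the sampled distance of `y` to a vector `s` of the subspace `S`. -/
theorem sub_div_le_sum_sub_sq {ι : Type*} [Fintype ι] [DecidableEq ι] {m : ℕ} (Ω : Fin m → ι)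
    (S : Submodule ℝ (EuclideanSpace ℝ ι)) (y s : EuclideanSpace ℝ ι) (hs : s ∈ S)
    {l : ℝ} (hl : 0 < l) (hls : l * ‖s‖ ^ 2 ≤ ∑ k, s (Ω k) ^ 2) :
    ∑ k, y (Ω k) ^ 2
        - ‖∑ k, y (Ω k) • S.starProjection (EuclideanSpace.single (Ω k) (1 : ℝ))‖ ^ 2 / l
      ≤ ∑ k, (y (Ω k) - s (Ω k)) ^ 2 := by
  set w := ∑ k, y (Ω k) • S.starProjection (EuclideanSpace.single (Ω k) (1 : ℝ)) with hw
  -- For `s ∈ S` the coordinate `s_j` equals `⟪P_S e_j, s⟫`, so the cross term depends on the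
  -- sampled `y` only through `w`.
  have hcross : ∑ k, y (Ω k) * s (Ω k) = ⟪w, s⟫ := by
    rw [hw, sum_inner]
    refine Finset.sum_congr rfl fun k _ => ?_
    rw [real_inner_smul_left, Submodule.inner_starProjection_left_eq_right,
      Submodule.starProjection_eq_self_iff.2 hs]
    simp [EuclideanSpace.inner_single_left]
  have hexp : ∑ k, (y (Ω k) - s (Ω k)) ^ 2
      = ∑ k, y (Ω k) ^ 2 - 2 * ⟪w, s⟫ + ∑ k, s (Ω k) ^ 2 := by
    rw [← hcross, Finset.mul_sum, ← Finset.sum_sub_distrib, ← Finset.sum_add_distrib]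
    exact Finset.sum_congr rfl fun k _ => by ring
  have hcs := real_inner_le_norm w s
  have hsq : 0 ≤ (‖w‖ / l - ‖s‖) ^ 2 * l := by positivity
  have he : (‖w‖ / l - ‖s‖) ^ 2 * l = ‖w‖ ^ 2 / l - 2 * (‖w‖ * ‖s‖) + l * ‖s‖ ^ 2 := by
    field_simp
    ring
  rw [hexp]
  linarith

end Residual

/-! ### Concentration of the sampled energy, the sampled projection, and sampled norms on `S`. -/

section Population

open RealInnerProductSpace

variable {ι : Type*} [Fintype ι]

theorem norm_sq_starProjection_single [DecidableEq ι] {S : Submodule ℝ (EuclideanSpace ℝ ι)}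
    {κ : Type*} [Fintype κ] (b : OrthonormalBasis κ ℝ S) (j : ι) :
    ‖S.starProjection (EuclideanSpace.single j (1 : ℝ))‖ ^ 2
      = ∑ i, (b i : EuclideanSpace ℝ ι) j ^ 2 := by
  rw [S.starProjection_apply, ← Submodule.coe_norm, ← b.sum_sq_norm_inner_right]
  refine Finset.sum_congr rfl fun i _ => ?_
  rw [Submodule.coe_inner, ← S.starProjection_apply,
    ← Submodule.inner_starProjection_left_eq_right,
    Submodule.starProjection_eq_self_iff.2 (b i).2]
  simp [EuclideanSpace.inner_single_right]

theorem sum_norm_sq_starProjection_single [DecidableEq ι] (S : Submodule ℝ (EuclideanSpace ℝ ι)) :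
    ∑ j, ‖S.starProjection (EuclideanSpace.single j (1 : ℝ))‖ ^ 2 = Module.finrank ℝ S := by
  simp only [norm_sq_starProjection_single (stdOrthonormalBasis ℝ S)]
  rw [Finset.sum_comm]
  have h : ∀ i, ∑ j, (stdOrthonormalBasis ℝ S i : EuclideanSpace ℝ ι) j ^ 2 = 1 := fun i => by
    have h1 := (stdOrthonormalBasis ℝ S).norm_eq_one i
    rw [← EuclideanSpace.real_norm_sq_eq, ← Submodule.coe_norm, h1, one_pow]
  simp [h]

/-- Sampling almost preserves, from below, the norms of the vectors of an incoherent subspace. -/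
theorem card_sampled_norm_le [DecidableEq ι] [Nonempty ι] (S : Submodule ℝ (EuclideanSpace ℝ ι))
    {R : ℝ} (hR0 : 0 < R)
    (hR : ∀ j, ‖S.starProjection (EuclideanSpace.single j (1 : ℝ))‖ ^ 2 ≤ R) {m : ℕ} {γ : ℝ}
    (hγ : 0 ≤ γ) (p : (Fin m → ι) → Prop) [DecidablePred p]
    (hp : ∀ Ω, p Ω → ∃ s ∈ S, s ≠ 0 ∧
      ∑ k, s (Ω k) ^ 2 ≤ (1 - γ) * (m / Fintype.card ι) * ‖s‖ ^ 2) :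
    ((Finset.univ.filter p).card : ℝ) ≤ (Fintype.card ι : ℝ) ^ m
      * (Module.finrank ℝ S * Real.exp (-(γ ^ 2 * m / (2 * (Fintype.card ι * R))))) := by
  -- The rows of an orthonormal basis of `S` form an isotropic family whose squared norms are `‖P_S
  -- e_j‖²`; the columns of `lmat U` need not be orthonormal.
  set b := stdOrthonormalBasis ℝ S with hb
  have hcoord : ∀ (s : S) j, (s : EuclideanSpace ℝ ι) j
      = (fun i => (b i : EuclideanSpace ℝ ι) j) ⬝ᵥ fun i => ⟪b i, s⟫ := fun s j => by
    conv_lhs => rw [← b.sum_repr' s]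
    simp [dotProduct, mul_comm]
  have h := card_matrix_chernoff (fun j i => (b i : EuclideanSpace ℝ ι) j) ?_ hR0 ?_ hγ p ?_
  · simpa using h
  · ext a c
    have h1 := orthonormal_iff_ite.1 b.orthonormal a c
    rw [Submodule.coe_inner, PiLp.inner_apply] at h1
    rw [Matrix.sum_apply, Matrix.one_apply, ← h1]
    refine Finset.sum_congr rfl fun j _ => ?_
    simp [Matrix.vecMulVec_apply, mul_comm]
  · intro j
    refine le_trans (le_of_eq ?_) (hR j)
    rw [norm_sq_starProjection_single b]
    simp [dotProduct, pow_two]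
  · intro Ω hΩ
    obtain ⟨s, hs, hs0, hle⟩ := hp Ω hΩ
    have hn : (fun i => ⟪b i, (⟨s, hs⟩ : S)⟫) ⬝ᵥ (fun i => ⟪b i, (⟨s, hs⟩ : S)⟫) = ‖s‖ ^ 2 := by
      have := b.sum_sq_norm_inner_right (⟨s, hs⟩ : S)
      rw [Submodule.coe_norm] at this
      rw [← this]
      simp [dotProduct, pow_two]
    refine ⟨fun i => ⟪b i, (⟨s, hs⟩ : S)⟫, ?_, ?_⟩
    · intro h0
      rw [h0, zero_dotProduct] at hn
      exact hs0 (norm_eq_zero.1 (pow_eq_zero_iff two_ne_zero |>.1 hn.symm))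
    · rw [hn]
      refine le_trans (le_of_eq ?_) hle
      exact Finset.sum_congr rfl fun k _ => by rw [← hcoord ⟨s, hs⟩]

variable (y : EuclideanSpace ℝ ι) {v Q : ℝ}

theorem mean_sq_le_max_sq [Nonempty ι] (hv : ‖y‖ ^ 2 = Fintype.card ι * v) (hQ : ∀ j, y j ^ 2 ≤ Q) :
    v ≤ Q := by
  have hN : (0 : ℝ) < Fintype.card ι := by exact_mod_cast Fintype.card_pos
  refine le_of_mul_le_mul_left ?_ hN
  rw [← hv, EuclideanSpace.real_norm_sq_eq]
  refine (Finset.sum_le_sum fun j _ => hQ j).trans ?_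
  simp

/-- The variance proxy comes from `y_j ^ 4 ≤ Q * y_j ^ 2`. -/
theorem sum_sq_sub_mean_le (hv : ‖y‖ ^ 2 = Fintype.card ι * v) (hQ : ∀ j, y j ^ 2 ≤ Q) :
    ∑ j, (y j ^ 2 - v) ^ 2 ≤ Fintype.card ι * (v * (Q - v)) := by
  rw [EuclideanSpace.real_norm_sq_eq] at hv
  calc ∑ j, (y j ^ 2 - v) ^ 2 ≤ ∑ j, ((Q - 2 * v) * y j ^ 2 + v ^ 2) := by
        refine Finset.sum_le_sum fun j _ => ?_
        nlinarith [mul_le_mul_of_nonneg_left (hQ j) (sq_nonneg (y j))]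
    _ = Fintype.card ι * (v * (Q - v)) := by
        rw [Finset.sum_add_distrib, ← Finset.mul_sum, hv]
        simp
        ring

theorem sum_sq_sub_mean_eq_zero (hv : ‖y‖ ^ 2 = Fintype.card ι * v) :
    ∑ j, (y j ^ 2 - v) = 0 := by
  rw [EuclideanSpace.real_norm_sq_eq] at hv
  rw [Finset.sum_sub_distrib, hv]
  simp

theorem card_sampled_energy_gt [Nonempty ι] (hv : ‖y‖ ^ 2 = Fintype.card ι * v)
    (hQ : ∀ j, y j ^ 2 ≤ Q) (hv0 : 0 ≤ v) {m : ℕ} {L : ℝ} (hL : 0 ≤ L)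
    (p : (Fin m → ι) → Prop) [DecidablePred p]
    (hp : ∀ Ω, p Ω → m * v + Real.sqrt (2 * (m * (v * (Q - v))) * L) + (Q - v) * L / 3
      < ∑ k, y (Ω k) ^ 2) :
    ((Finset.univ.filter p).card : ℝ) ≤ (Fintype.card ι : ℝ) ^ m * Real.exp (-L) := by
  have hB : 0 ≤ Q - v := sub_nonneg.2 (mean_sq_le_max_sq y hv hQ)
  refine card_bernstein (fun j => y j ^ 2 - v) hB hL (by positivity)
    (sum_sq_sub_mean_eq_zero y hv) (fun j => sub_le_sub_right (hQ j) _)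
    (sum_sq_sub_mean_le y hv hQ) p fun Ω hΩ => ?_
  have := hp Ω hΩ
  rw [Finset.sum_sub_distrib]
  simp only [Finset.sum_const, Finset.card_univ, Fintype.card_fin, nsmul_eq_mul]
  linarith

/-- For the lower tail the centred variable `v - y_j ^ 2` is at most `v`, not `Q - v`; hence the
term `v * L / 3`. -/
theorem card_sampled_energy_lt [Nonempty ι] (hv : ‖y‖ ^ 2 = Fintype.card ι * v)
    (hQ : ∀ j, y j ^ 2 ≤ Q) (hv0 : 0 ≤ v) {m : ℕ} {L : ℝ} (hL : 0 ≤ L)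
    (p : (Fin m → ι) → Prop) [DecidablePred p]
    (hp : ∀ Ω, p Ω → ∑ k, y (Ω k) ^ 2
      < m * v - Real.sqrt (2 * (m * (v * (Q - v))) * L) - v * L / 3) :
    ((Finset.univ.filter p).card : ℝ) ≤ (Fintype.card ι : ℝ) ^ m * Real.exp (-L) := by
  have hB : 0 ≤ Q - v := sub_nonneg.2 (mean_sq_le_max_sq y hv hQ)
  refine card_bernstein (fun j => v - y j ^ 2) hv0 hL (σ2 := v * (Q - v)) (by positivity)
    ?_ (fun j => by linarith [sq_nonneg (y j)]) ?_ p fun Ω hΩ => ?_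
  · have := sum_sq_sub_mean_eq_zero y hv
    rw [Finset.sum_sub_distrib] at this ⊢
    linarith
  · refine le_trans (le_of_eq ?_) (sum_sq_sub_mean_le y hv hQ)
    exact Finset.sum_congr rfl fun j _ => by ring
  · have := hp Ω hΩ
    rw [Finset.sum_sub_distrib]
    simp only [Finset.sum_const, Finset.card_univ, Fintype.card_fin, nsmul_eq_mul]
    linarith

/-- The vectors `y_j P_S e_j` sum to `P_S y = 0`, have squared norm at most `Q * R`, and total
squared norm at most `R * ‖y‖²`. -/
theorem card_sampled_projection_gt [DecidableEq ι] (S : Submodule ℝ (EuclideanSpace ℝ ι))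
    (hy : y ∈ Sᗮ)
    {R : ℝ} (hR : ∀ j, ‖S.starProjection (EuclideanSpace.single j (1 : ℝ))‖ ^ 2 ≤ R) (hR0 : 0 ≤ R)
    (hv : ‖y‖ ^ 2 = Fintype.card ι * v) (hQ : ∀ j, y j ^ 2 ≤ Q) (hv0 : 0 ≤ v) {m : ℕ} {L : ℝ}
    (hL : 0 ≤ L) (p : (Fin m → ι) → Prop) [DecidablePred p]
    (hp : ∀ Ω, p Ω → Real.sqrt (2 * (m * (R * v)) * L) + Real.sqrt (Q * R) * L / 3
      < ‖∑ k, y (Ω k) • S.starProjection (EuclideanSpace.single (Ω k) (1 : ℝ))‖) :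
    ((Finset.univ.filter p).card : ℝ) ≤ (Fintype.card ι : ℝ) ^ m * (2 * Real.exp (-L)) := by
  have hn : ∀ j, ‖y j • S.starProjection (EuclideanSpace.single j (1 : ℝ))‖ ^ 2
      = y j ^ 2 * ‖S.starProjection (EuclideanSpace.single j (1 : ℝ))‖ ^ 2 := fun j => by
    rw [norm_smul, mul_pow, Real.norm_eq_abs, sq_abs]
  refine card_bernstein_vector
    (fun j => y j • S.starProjection (EuclideanSpace.single j (1 : ℝ))) (Real.sqrt_nonneg _) hL
    (by positivity) ?_ (fun j => ?_) ?_ p hp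
  · have hy' : ∑ j, y j • EuclideanSpace.single j (1 : ℝ) = y := by
      have := (EuclideanSpace.basisFun ι ℝ).sum_repr y
      simpa using this
    rw [← (Submodule.starProjection_apply_eq_zero_iff S).2 hy]
    conv_rhs => rw [← hy', map_sum]
    simp
  · refine Real.le_sqrt_of_sq_le ?_
    rw [hn]
    have := (sq_nonneg (y j)).trans (hQ j)
    exact mul_le_mul (hQ j) (hR j) (sq_nonneg _) this
  · calc ∑ j, ‖y j • S.starProjection (EuclideanSpace.single j (1 : ℝ))‖ ^ 2
        ≤ ∑ j, y j ^ 2 * R := Finset.sum_le_sum fun j _ => by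
          rw [hn]; exact mul_le_mul_of_nonneg_left (hR j) (sq_nonneg _)
      _ = Fintype.card ι * (R * v) := by
          rw [← Finset.sum_mul, ← EuclideanSpace.real_norm_sq_eq, hv]; ring

end Population

/-! ### From counting samples to probabilities. -/

section Sampling

open MeasureTheory ProbabilityTheory

/-- Events about independent uniform draws have probabilities given by counting. -/
theorem measureReal_sample_eq {ι : Type*} [Fintype ι] [Nonempty ι] [MeasurableSpace ι]
    [MeasurableSingletonClass ι] {Ω₀ : Type*} [MeasurableSpace Ω₀] (μ : Measure Ω₀)
    [IsProbabilityMeasure μ] {m : ℕ} (Ω : Fin m → Ω₀ → ι) (hΩ : ∀ k, Measurable (Ω k))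
    (hindep : iIndepFun Ω μ) (hunif : ∀ k, μ.map (Ω k) = uniformOn Set.univ)
    (p : (Fin m → ι) → Prop) [DecidablePred p] :
    μ.real {ω | p fun k => Ω k ω}
      = ((Finset.univ.filter p).card : ℝ) / (Fintype.card ι : ℝ) ^ m := by
  have hmeas : Measurable fun ω k => Ω k ω := measurable_pi_lambda _ hΩ
  have hmap := (iIndepFun_iff_map_fun_eq_pi_map fun k => (hΩ k).aemeasurable).1 hindep
  have hprob : ∀ k, IsProbabilityMeasure (μ.map (Ω k)) := fun k =>
    Measure.isProbabilityMeasure_map (hΩ k).aemeasurable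
  have hsingle : ∀ f : Fin m → ι, (μ.map fun ω k => Ω k ω).real {f}
      = ((Fintype.card ι : ℝ) ^ m)⁻¹ := fun f => by
    rw [hmap, Measure.real, Measure.pi_singleton, ENNReal.toReal_prod]
    simp [hunif, uniformOn_univ]
  have : IsProbabilityMeasure (μ.map fun ω k => Ω k ω) :=
    Measure.isProbabilityMeasure_map hmeas.aemeasurable
  have hset : {ω | p fun k => Ω k ω}
      = (fun ω k => Ω k ω) ⁻¹' (Finset.univ.filter p : Finset (Fin m → ι)) := by
    ext ω
    simp
  rw [hset, ← map_measureReal_apply hmeas (Finset.measurableSet _), ← sum_measureReal_singleton]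
  simp [hsingle, div_eq_mul_inv]

end Sampling

/-! ### Numerical constants, and auxiliary facts on coherence, dimension and angle. -/

theorem sqrt_add_sqrt_mul_le {L : ℝ} (hL : Real.log 4 ≤ L) :
    Real.sqrt (2 * (L + Real.log 2)) + Real.sqrt (7 / (8 * L)) * (L + Real.log 2) / 3
      ≤ 1 + 191 / 100 * Real.sqrt L := by
  have hlog2 := Real.log_two_lt_d9
  have hlog2' := Real.log_two_gt_d9
  have hlog4 : Real.log 4 = 2 * Real.log 2 := by
    rw [show (4 : ℝ) = 2 ^ 2 by norm_num, Real.log_pow]; norm_num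
  have hL1 : 1.38 ≤ L := by linarith
  set r := Real.sqrt L with hr
  have hr2 : r ^ 2 = L := Real.sq_sqrt (by linarith)
  have hr1 : 1.17 ≤ r := Real.le_sqrt_of_sq_le (by norm_num; linarith)
  have h1 : Real.sqrt (2 * (L + Real.log 2)) ≤ 1.4143 * r + 0.43 := by
    refine Real.sqrt_le_iff.2 ⟨by positivity, ?_⟩
    rw [← hr2]
    nlinarith
  have h2 : Real.sqrt (7 / (8 * L)) ≤ 0.936 / r := by
    refine Real.sqrt_le_iff.2 ⟨by positivity, ?_⟩
    rw [div_pow, hr2, div_le_div_iff₀ (by linarith) (by linarith)]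
    nlinarith
  have h3 : Real.sqrt (7 / (8 * L)) * (L + Real.log 2) ≤ 0.936 * (r + 0.6) := by
    calc Real.sqrt (7 / (8 * L)) * (L + Real.log 2) ≤ 0.936 / r * (r ^ 2 + 0.6 * r) := by
          gcongr
          · rw [hr2]
          · linarith
      _ = 0.936 * (r + 0.6) := by field_simp
  linarith

/-- This fixes the constant `1.91`: its square must be at most `4 - 1 / 3`, leaving room for the
stray term of the lower tail. -/
theorem sq_add_div_three_le {L : ℝ} (hL : 0 ≤ L) :
    (1 + 191 / 100 * Real.sqrt L) ^ 2 + L / 3 ≤ (1 + 2 * Real.sqrt L) ^ 2 := by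
  have h := Real.sq_sqrt hL
  have h0 := Real.sqrt_nonneg L
  nlinarith

/-- The scalar Bernstein deviation in terms of the relative deviation. -/
theorem sqrt_two_mul_eq {μ v B L : ℝ} (hμ : 0 < μ) (hv : 0 < v) :
    Real.sqrt (2 * (μ * (v * B)) * L) = μ * v * Real.sqrt (2 * B / (μ * v) * L) := by
  have h : 2 * (μ * (v * B)) * L = (μ * v) ^ 2 * (2 * B / (μ * v) * L) := by field_simp
  rw [h, Real.sqrt_mul (by positivity), Real.sqrt_sq (by positivity)]

theorem sampled_energy_upper {μ v B L α A : ℝ} (hμ : 0 < μ) (hv : 0 < v) (hB : 0 ≤ B) (hL : 0 ≤ L)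
    (hα : α = Real.sqrt (2 * B / (μ * v) * L) + 2 * B / (3 * (μ * v)) * L)
    (hA : A ≤ μ * v + Real.sqrt (2 * (μ * (v * B)) * L) + B * L / 3) :
    A ≤ (1 + α) * (μ * v) := by
  rw [sqrt_two_mul_eq hμ hv] at hA
  have h : μ * v * (2 * B / (3 * (μ * v)) * L) = 2 * (B * L / 3) := by field_simp
  have : 0 ≤ B * L / 3 := by positivity
  rw [hα]
  linarith

theorem sampled_energy_lower {μ v B L α A : ℝ} (hμ : 0 < μ) (hv : 0 < v) (hB : 0 ≤ B) (hL : 0 ≤ L)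
    (hα : α = Real.sqrt (2 * B / (μ * v) * L) + 2 * B / (3 * (μ * v)) * L)
    (hA : μ * v - Real.sqrt (2 * (μ * (v * B)) * L) - v * L / 3 ≤ A) :
    (1 - α) * (μ * v) - v * L / 3 ≤ A := by
  rw [sqrt_two_mul_eq hμ hv] at hA
  have h : μ * v * (2 * B / (3 * (μ * v)) * L) = 2 * (B * L / 3) := by field_simp
  have : 0 ≤ B * L / 3 := by positivity
  rw [hα]
  linarith

/-- With `B = Q - v`, the condition `α < 1` gives `B ≤ μ v / (2 L)` and `8 / 3 * L ≤ μ` gives `v ≤ 3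
μ v / (8 L)`. So `Q ≤ 7 μ v / (8 L)`, and the linear Bernstein term is of the same order as the
square root term. -/
theorem sampled_projection_sq_le {μ v B L α R w : ℝ} (hμ : 0 < μ) (hv : 0 < v) (hB : 0 ≤ B)
    (hL : Real.log 4 ≤ L) (hLμ : 8 / 3 * L ≤ μ) (hR : 0 ≤ R) (hw0 : 0 ≤ w)
    (hα : α = Real.sqrt (2 * B / (μ * v) * L) + 2 * B / (3 * (μ * v)) * L) (hα1 : α < 1)
    (hw : w ≤ Real.sqrt (2 * (μ * (R * v)) * (L + Real.log 2))
      + Real.sqrt ((v + B) * R) * (L + Real.log 2) / 3) :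
    w ^ 2 ≤ μ * R * v * (1 + 191 / 100 * Real.sqrt L) ^ 2 := by
  have hL0 : 0 < L := (Real.log_pos (by norm_num)).trans_le hL
  have hlog2 : 0 < Real.log 2 := Real.log_pos one_lt_two
  have hsq : Real.sqrt (2 * B / (μ * v) * L) < 1 := by
    have : 0 ≤ 2 * B / (3 * (μ * v)) * L := by positivity
    linarith
  have hBL : 2 * B * L < μ * v := by
    rw [Real.sqrt_lt' one_pos, one_pow, div_mul_eq_mul_div, div_lt_one (by positivity)] at hsq
    exact hsq
  have h1 : Real.sqrt (2 * (μ * (R * v)) * (L + Real.log 2))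
      = Real.sqrt (μ * R * v) * Real.sqrt (2 * (L + Real.log 2)) := by
    rw [← Real.sqrt_mul (by positivity)]
    congr 1
    ring
  have h2 : Real.sqrt ((v + B) * R) ≤ Real.sqrt (μ * R * v) * Real.sqrt (7 / (8 * L)) := by
    rw [← Real.sqrt_mul (by positivity)]
    refine Real.sqrt_le_sqrt ?_
    have h3 : v + B ≤ μ * v * (7 / (8 * L)) := by
      rw [mul_div_assoc', le_div_iff₀ (by positivity)]
      nlinarith
    calc (v + B) * R ≤ μ * v * (7 / (8 * L)) * R := mul_le_mul_of_nonneg_right h3 hR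
      _ = μ * R * v * (7 / (8 * L)) := by ring
  have h4 : w ≤ Real.sqrt (μ * R * v) * (1 + 191 / 100 * Real.sqrt L) := by
    calc w ≤ _ := hw
      _ ≤ Real.sqrt (μ * R * v) * Real.sqrt (2 * (L + Real.log 2))
          + Real.sqrt (μ * R * v) * Real.sqrt (7 / (8 * L)) * (L + Real.log 2) / 3 := by
          rw [h1]
          gcongr
      _ = Real.sqrt (μ * R * v) * (Real.sqrt (2 * (L + Real.log 2))
          + Real.sqrt (7 / (8 * L)) * (L + Real.log 2) / 3) := by ring
      _ ≤ _ := mul_le_mul_of_nonneg_left (sqrt_add_sqrt_mul_le hL) (Real.sqrt_nonneg _)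
  calc w ^ 2 ≤ (Real.sqrt (μ * R * v) * (1 + 191 / 100 * Real.sqrt L)) ^ 2 := by gcongr
    _ = _ := by rw [mul_pow, Real.sq_sqrt (by positivity)]

/-- The final combination of the lower bounds. -/
theorem residual_lower {μ N v L α γ R A E w : ℝ} (hμ : 0 < μ) (hN : 0 < N) (hv : 0 ≤ v)
    (hL : 0 ≤ L) (hγ0 : 0 ≤ γ) (hγ : γ < 1) (hNR : 1 ≤ N * R)
    (hA : (1 - α) * (μ * v) - v * L / 3 ≤ A)
    (hw : w ^ 2 ≤ μ * R * v * (1 + 191 / 100 * Real.sqrt L) ^ 2)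
    (hE : A - w ^ 2 / ((1 - γ) * (μ / N)) ≤ E) :
    (μ * (1 - α) - N * R * ((1 + 2 * Real.sqrt L) ^ 2 / (1 - γ))) * v ≤ E := by
  have hg : 0 < 1 - γ := by linarith
  set c := (1 + 191 / 100 * Real.sqrt L) ^ 2 with hc
  have h1 : w ^ 2 / ((1 - γ) * (μ / N)) ≤ N * R * (c / (1 - γ)) * v := by
    calc w ^ 2 / ((1 - γ) * (μ / N)) ≤ μ * R * v * c / ((1 - γ) * (μ / N)) := by gcongr
      _ = N * R * (c / (1 - γ)) * v := by field_simp
  -- The slack in `β` is at least `L / 3`, and the factors `N * R` and `1 / (1 - γ)` are at least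
  -- `1`.
  have h2 : L / 3 ≤ N * R * ((1 + 2 * Real.sqrt L) ^ 2 / (1 - γ)) - N * R * (c / (1 - γ)) := by
    have h3 := sq_add_div_three_le hL
    have h4 : L / 3 ≤ ((1 + 2 * Real.sqrt L) ^ 2 - c) / (1 - γ) := by
      rw [le_div_iff₀ hg]
      nlinarith
    have h5 : 0 ≤ L / 3 := by positivity
    calc L / 3 ≤ ((1 + 2 * Real.sqrt L) ^ 2 - c) / (1 - γ) := h4
      _ ≤ N * R * (((1 + 2 * Real.sqrt L) ^ 2 - c) / (1 - γ)) :=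
        le_mul_of_one_le_left (h5.trans h4) hNR
      _ = _ := by ring
  have h6 := mul_le_mul_of_nonneg_right h2 hv
  linarith

/-- For this `γ` the Chernoff exponent is `4 / 3 * log (2 K / δ)`, more than needed for failure
probability `δ / 2`. -/
theorem finrank_mul_exp_le {d K δ D γ μ : ℝ} (hd : d ≤ K) (hK : 1 ≤ K) (hδ0 : 0 < δ)
    (hδ : δ ≤ 1) (hD : 0 < D) (hμ : 0 < μ)
    (hγ : γ ^ 2 = 8 * D / (3 * μ) * Real.log (2 * K / δ)) :
    d * Real.exp (-(γ ^ 2 * μ / (2 * D))) ≤ δ := by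
  have hl : 0 ≤ Real.log (2 * K / δ) := Real.log_nonneg (by rw [le_div_iff₀ hδ0]; linarith)
  have h1 : γ ^ 2 * μ / (2 * D) = 4 / 3 * Real.log (2 * K / δ) := by
    rw [hγ]; field_simp; ring
  have h2 : Real.exp (-(γ ^ 2 * μ / (2 * D))) ≤ δ / (2 * K) := by
    calc Real.exp (-(γ ^ 2 * μ / (2 * D))) ≤ Real.exp (-Real.log (2 * K / δ)) := by
          rw [h1]; exact Real.exp_le_exp.2 (by linarith)
      _ = δ / (2 * K) := by rw [Real.exp_neg, Real.exp_log (by positivity), inv_div]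
  calc d * Real.exp (-(γ ^ 2 * μ / (2 * D))) ≤ K * (δ / (2 * K)) := by
        gcongr
    _ = δ / 2 := by field_simp
    _ ≤ δ := by linarith

theorem natCast_mul_coherence {n₁ n₂ n₃ : ℕ} (hn₂ : 0 < n₂)
    (S : Submodule ℝ (EuclideanSpace ℝ (Fin n₁ × Fin n₃))) :
    (n₂ : ℝ) * n₃ * coherence n₂ S
      = n₁ * n₃ * ⨆ j, ‖S.starProjection (EuclideanSpace.single j (1 : ℝ))‖ ^ 2 := by
  have : (n₂ : ℝ) ≠ 0 := by positivity
  rw [coherence]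
  field_simp

theorem finrank_vectorSubspace_le {n₁ n₂ n₃ : ℕ} (L : DiscreteTransform n₃)
    (U : Tensor n₁ n₂ n₃) : Module.finrank ℝ (vectorSubspace L U) ≤ n₂ * n₃ := by
  refine (finrank_range_le_card _).trans ?_
  simp

theorem finrank_vectorSubspace_pos {n₁ n₂ n₃ : ℕ} (hn₂ : 0 < n₂) (hn₃ : 0 < n₃)
    (L : DiscreteTransform n₃) {U : Tensor n₁ n₂ n₃} {G : Tensor n₂ n₂ n₃}
    (hG : IsTensorInverse L (tensorMul L (tensorTranspose L U) U) G) :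
    0 < Module.finrank ℝ (vectorSubspace L U) := by
  rw [Module.finrank_pos_iff, Submodule.nontrivial_iff_ne_bot]
  intro hbot
  have hmem : WithLp.toLp 2 (lmat L U *ᵥ fun _ => 1) ∈ vectorSubspace L U :=
    (mem_vectorSubspace_iff L U _).2 ⟨_, rfl⟩
  rw [hbot, Submodule.mem_bot, WithLp.toLp_eq_zero] at hmem
  have h := lmat_mulVec_injective L hG (hmem.trans (Matrix.mulVec_zero _).symm)
  exact one_ne_zero (congrFun h (⟨0, hn₂⟩, ⟨0, hn₃⟩))

theorem sq_le_maxAbs_sq {n₁ n₃ : ℕ} (y : EuclideanSpace ℝ (Fin n₁ × Fin n₃))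
    (j : Fin n₁ × Fin n₃) : y j ^ 2 ≤ maxAbs y ^ 2 := by
  rw [← sq_abs]
  have : |y j| ≤ maxAbs y := le_ciSup (f := fun j => |y j|) (Set.finite_range _).bddAbove j
  gcongr

/-- Holds also for `u = 0`, where the cosine is `0 / 0 = 0`. -/
theorem cosAngle_sq_mul {n₁ n₃ : ℕ} (u : EuclideanSpace ℝ (Fin n₁ × Fin n₃))
    (W : Submodule ℝ (EuclideanSpace ℝ (Fin n₁ × Fin n₃))) :
    cosAngle u W ^ 2 * ‖u‖ ^ 2 = ‖W.starProjection u‖ ^ 2 := by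
  rw [cosAngle, ← mul_pow]
  rcases eq_or_ne u 0 with rfl | hu
  · simp
  · rw [div_mul_cancel₀ _ (norm_ne_zero_iff.2 hu)]

/-! ### The union bound and the main theorem. -/

section UnionBound

open MeasureTheory ProbabilityTheory

open scoped Classical in
/-- A union bound for four bad events of a uniform sample. -/
theorem one_sub_four_mul_le_measureReal {ι : Type*} [Fintype ι] [Nonempty ι] [MeasurableSpace ι]
    [MeasurableSingletonClass ι] {Ω₀ : Type*} [MeasurableSpace Ω₀] (μ : Measure Ω₀)
    [IsProbabilityMeasure μ] {m : ℕ} (Ω : Fin m → Ω₀ → ι) (hΩ : ∀ k, Measurable (Ω k))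
    (hindep : iIndepFun Ω μ) (hunif : ∀ k, μ.map (Ω k) = uniformOn Set.univ) {δ : ℝ}
    (g e₁ e₂ e₃ e₄ : (Fin m → ι) → Prop)
    (h : ∀ ω, ¬ e₁ ω → ¬ e₂ ω → ¬ e₃ ω → ¬ e₄ ω → g ω)
    (h₁ : ((Finset.univ.filter e₁).card : ℝ) ≤ (Fintype.card ι : ℝ) ^ m * δ)
    (h₂ : ((Finset.univ.filter e₂).card : ℝ) ≤ (Fintype.card ι : ℝ) ^ m * δ)
    (h₃ : ((Finset.univ.filter e₃).card : ℝ) ≤ (Fintype.card ι : ℝ) ^ m * δ)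
    (h₄ : ((Finset.univ.filter e₄).card : ℝ) ≤ (Fintype.card ι : ℝ) ^ m * δ) :
    1 - 4 * δ ≤ μ.real {ω | g fun k => Ω k ω} := by
  rw [measureReal_sample_eq μ Ω hΩ hindep hunif g]
  have hN : (0 : ℝ) < (Fintype.card ι : ℝ) ^ m := by
    have : (0 : ℝ) < Fintype.card ι := by exact_mod_cast Fintype.card_pos
    positivity
  rw [le_div_iff₀ hN]
  have hsub : (Finset.univ : Finset (Fin m → ι)) ⊆ Finset.univ.filter g ∪ Finset.univ.filter e₁
      ∪ Finset.univ.filter e₂ ∪ Finset.univ.filter e₃ ∪ Finset.univ.filter e₄ := by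
    intro ω _
    have := h ω
    simp only [Finset.mem_union, Finset.mem_filter, Finset.mem_univ, true_and]
    tauto
  have hcard : (Fintype.card ι) ^ m ≤ (Finset.univ.filter g).card + (Finset.univ.filter e₁).card
      + (Finset.univ.filter e₂).card + (Finset.univ.filter e₃).card
      + (Finset.univ.filter e₄).card := by
    refine le_trans (le_of_eq ?_) ((Finset.card_le_card hsub).trans ?_)
    · simp
    · refine (Finset.card_union_le _ _).trans (Nat.add_le_add_right ?_ _)
      refine (Finset.card_union_le _ _).trans (Nat.add_le_add_right ?_ _)
      refine (Finset.card_union_le _ _).trans (Nat.add_le_add_right ?_ _)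
      exact Finset.card_union_le _ _
  have hcard' : (Fintype.card ι : ℝ) ^ m ≤ (Finset.univ.filter g).card
      + (Finset.univ.filter e₁).card + (Finset.univ.filter e₂).card
      + (Finset.univ.filter e₃).card + (Finset.univ.filter e₄).card := by
    exact_mod_cast hcard
  linarith

end UnionBound

theorem theorem2 {n₁ n₂ n₃ m : ℕ} (hn₁ : 0 < n₁) (hn₂ : 0 < n₂) (hn₃ : 0 < n₃)
    -- the transform, the tensor spanning the subspace, and the projection `P = U•(U†•U)⁻¹•U†`
    (L : DiscreteTransform n₃) (U : Tensor n₁ n₂ n₃) (G : Tensor n₂ n₂ n₃)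
    (hG : IsTensorInverse L (tensorMul L (tensorTranspose L U) U) G)
    (P : Tensor n₁ n₁ n₃) (hP : P = tensorMul L (tensorMul L U G) (tensorTranspose L U))
    -- the signal and its decomposition
    (T X Y : Tensor n₁ 1 n₃) (hT : T = X + Y) (hX : X ∈ tensorColumnSpace L U)
    (hY : Y ∈ tensorOrthogonal L (tensorColumnSpace L U))
    (S : Submodule ℝ (EuclideanSpace ℝ (Fin n₁ × Fin n₃))) (hS : S = vectorSubspace L U)
    (y : EuclideanSpace ℝ (Fin n₁ × Fin n₃)) (hy : y = Sᗮ.starProjection (unfold T))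
    -- the `m` draws: independent and uniform on all positions
    {Ω₀ : Type*} [MeasurableSpace Ω₀] (ℙ : MeasureTheory.Measure Ω₀)
    [MeasureTheory.IsProbabilityMeasure ℙ]
    (Ω : Fin m → Ω₀ → Fin n₁ × Fin n₃) (hΩ : ∀ k, Measurable (Ω k))
    (hindep : ProbabilityTheory.iIndepFun Ω ℙ)
    (hunif : ∀ k, ℙ.map (Ω k) = ProbabilityTheory.uniformOn Set.univ)
    -- the parameters
    (δ α β γ : ℝ) (hδ : 0 < δ)
    (hα : α = Real.sqrt (2 * (n₁ * n₃ * maxAbs y ^ 2 - ‖y‖ ^ 2) / (m * ‖y‖ ^ 2) * Real.log (1 / δ))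
      + 2 * (n₁ * n₃ * maxAbs y ^ 2 - ‖y‖ ^ 2) / (3 * m * ‖y‖ ^ 2) * Real.log (1 / δ))
    (hβ : β = (1 + 2 * Real.sqrt (Real.log (1 / δ))) ^ 2)
    (hγ : γ = Real.sqrt (8 * n₂ * n₃ * coherence n₂ S / (3 * m) * Real.log (2 * n₂ * n₃ / δ)))
    (hm : 8 / 3 * n₂ * n₃ * coherence n₂ S * Real.log (2 * n₂ * n₃ / δ) ≤ m) :
    1 - 4 * δ ≤ ℙ.real {ω |
      -- `P_Ω` is well defined
      IsUnit ((sampleMat (fun k => Ω k ω) (lmat L U))ᵀ * sampleMat (fun k => Ω k ω) (lmat L U)) ∧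
      -- the lower bound (void if `γ = 1`, when `β / (1 - γ)` is infinite)
      (γ < 1 →
        (m * (1 - α) - n₂ * n₃ * coherence n₂ S * (β / (1 - γ))) / (n₁ * n₃)
            * cosAngle (unfold Y) Sᗮ ^ 2 * frobNorm (T - tensorMul L P T) ^ 2
          ≤ residualEnergy (fun k => Ω k ω) (lmat L U) (unfold T)) ∧
      -- the upper bound
      residualEnergy (fun k => Ω k ω) (lmat L U) (unfold T)
        ≤ (1 + α) * (m / (n₁ * n₃)) * cosAngle (unfold Y) Sᗮ ^ 2
            * frobNorm (T - tensorMul L P T) ^ 2} := by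
  classical
  -- For `δ ≥ 1 / 4` the claimed probability is nonpositive. Otherwise `log (1 / δ) ≥ log 4`, on
  -- which the numerical constants rely.
  rcases le_total (1 / 4) δ with hδ4 | hδ4
  · exact le_trans (by linarith) MeasureTheory.measureReal_nonneg
  have hne : Nonempty (Fin n₁ × Fin n₃) := ⟨(⟨0, hn₁⟩, ⟨0, hn₃⟩)⟩
  set N := (Fintype.card (Fin n₁ × Fin n₃) : ℝ) with hN
  have hNeq : N = n₁ * n₃ := by simp [hN]
  have hN0 : 0 < N := by rw [hNeq]; positivity
  set R := ⨆ j, ‖S.starProjection (EuclideanSpace.single j (1 : ℝ))‖ ^ 2 with hRdef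
  have hR : ∀ j, ‖S.starProjection (EuclideanSpace.single j (1 : ℝ))‖ ^ 2 ≤ R := fun j =>
    le_ciSup (f := fun j => ‖S.starProjection (EuclideanSpace.single j (1 : ℝ))‖ ^ 2)
      (Set.finite_range _).bddAbove j
  have hcoh : (n₂ : ℝ) * n₃ * coherence n₂ S = N * R := by
    rw [hNeq]; exact natCast_mul_coherence hn₂ S
  have hdpos : (1 : ℝ) ≤ Module.finrank ℝ S := by
    rw [hS]; exact_mod_cast finrank_vectorSubspace_pos hn₂ hn₃ L hG
  have hdle : (Module.finrank ℝ S : ℝ) ≤ n₂ * n₃ := by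
    rw [hS]; exact_mod_cast finrank_vectorSubspace_le L U
  -- The trace of `P_S` is `dim S ≥ 1` and is at most `N` times the largest `‖P_S e_j‖²`.
  have hNR : 1 ≤ N * R := by
    refine hdpos.trans ?_
    rw [← sum_norm_sq_starProjection_single]
    refine (Finset.sum_le_sum fun j _ => hR j).trans ?_
    simp [hN]
  have hR0 : 0 < R := pos_of_mul_pos_right (zero_lt_one.trans_le hNR) hN0.le
  -- the logarithms
  set l := Real.log (1 / δ) with hl
  have hl4 : Real.log 4 ≤ l :=
    Real.log_le_log (by norm_num) (by rw [le_div_iff₀ hδ]; linarith)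
  have hl0 : 0 < l := (Real.log_pos (by norm_num)).trans_le hl4
  have hexpl : Real.exp (-l) = δ := by
    rw [hl, one_div, Real.log_inv, neg_neg, Real.exp_log hδ]
  set ll := Real.log (2 * n₂ * n₃ / δ) with hll
  have hK : (1 : ℝ) ≤ n₂ * n₃ := hdpos.trans hdle
  have hlll : l ≤ ll := by
    refine Real.log_le_log (by positivity) ?_
    gcongr
    linarith
  have hml : 8 / 3 * l ≤ m := by
    refine le_trans ?_ hm
    have : 8 / 3 * (n₂ : ℝ) * n₃ * coherence n₂ S * ll = 8 / 3 * (N * R * ll) := by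
      rw [← hcoh]; ring
    rw [this]
    have : ll ≤ N * R * ll := le_mul_of_one_le_left (hl0.le.trans hlll) hNR
    linarith
  have hm0 : (0 : ℝ) < m := by linarith
  have hγ' : γ = Real.sqrt (8 * (N * R) / (3 * m) * ll) := by
    rw [hγ, ← hcoh]; congr 3; ring
  have hll0 : 0 ≤ ll := hl0.le.trans hlll
  have hγ2 : γ ^ 2 = 8 * (N * R) / (3 * m) * ll := by
    rw [hγ', Real.sq_sqrt (by positivity)]
  have hγ0 : 0 ≤ γ := by rw [hγ']; positivity
  have hγ1 : γ ≤ 1 := by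
    rw [hγ', Real.sqrt_le_one]
    rw [div_mul_eq_mul_div, div_le_one (by positivity)]
    have : 8 / 3 * (n₂ : ℝ) * n₃ * coherence n₂ S * ll = 8 / 3 * (N * R * ll) := by
      rw [← hcoh]; ring
    rw [this] at hm
    linarith
  -- the residual vector
  have hyS : y ∈ Sᗮ := by rw [hy]; exact Submodule.starProjection_apply_mem _ _
  set v := ‖y‖ ^ 2 / N with hvdef
  have hv : ‖y‖ ^ 2 = N * v := by rw [hvdef]; field_simp
  have hv0 : 0 ≤ v := by positivity
  set Q := maxAbs y ^ 2 with hQdef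
  have hQ : ∀ j, y j ^ 2 ≤ Q := sq_le_maxAbs_sq y
  have hB : 0 ≤ Q - v := sub_nonneg.2 (mean_sq_le_max_sq y hv hQ)
  have hTadd : unfold T = unfold X + unfold Y := by rw [hT]; rfl
  -- For a general transform, tube orthogonality of `Y` does not make `unfold Y` Euclidean
  -- orthogonal to `S`; the cosine accounts for this.
  have henergy : cosAngle (unfold Y) Sᗮ ^ 2 * frobNorm (T - tensorMul L P T) ^ 2 = N * v := by
    have h1 : T - tensorMul L P T = Y := by
      rw [hT, hP]; exact sub_tensorMul_projection_eq L hG hX hY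
    rw [h1, frobNorm_sq_eq, cosAngle_sq_mul, ← hv, hy, hTadd, map_add]
    have h2 : Sᗮ.starProjection (unfold X) = 0 := by
      rw [Submodule.starProjection_apply_eq_zero_iff, Submodule.orthogonal_orthogonal, hS]
      exact unfold_mem_vectorSubspace L hX
    rw [h2, zero_add]
  obtain ⟨c, hc⟩ : ∃ c, S.starProjection (unfold T) = WithLp.toLp 2 (lmat L U *ᵥ c) := by
    rw [← mem_vectorSubspace_iff, ← hS]
    exact Submodule.starProjection_apply_mem _ _
  have hTy : unfold T = WithLp.toLp 2 (lmat L U *ᵥ c) + y := by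
    rw [← hc, hy]
    exact (Submodule.starProjection_add_starProjection_orthogonal (unfold T)).symm
  refine one_sub_four_mul_le_measureReal ℙ Ω hΩ hindep hunif
    (fun ω => IsUnit ((sampleMat ω (lmat L U))ᵀ * sampleMat ω (lmat L U)) ∧ (γ < 1 →
        (m * (1 - α) - n₂ * n₃ * coherence n₂ S * (β / (1 - γ))) / (n₁ * n₃)
            * cosAngle (unfold Y) Sᗮ ^ 2 * frobNorm (T - tensorMul L P T) ^ 2
          ≤ residualEnergy ω (lmat L U) (unfold T)) ∧
      residualEnergy ω (lmat L U) (unfold T)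
        ≤ (1 + α) * (m / (n₁ * n₃)) * cosAngle (unfold Y) Sᗮ ^ 2
            * frobNorm (T - tensorMul L P T) ^ 2)
    (fun ω => m * v + Real.sqrt (2 * (m * (v * (Q - v))) * l) + (Q - v) * l / 3
      < ∑ k, y (ω k) ^ 2)
    (fun ω => ∑ k, y (ω k) ^ 2 < m * v - Real.sqrt (2 * (m * (v * (Q - v))) * l) - v * l / 3)
    -- The shift by `log 2` cancels the factor `2` of the vector Bernstein bound.
    (fun ω => Real.sqrt (2 * (m * (R * v)) * (l + Real.log 2))
        + Real.sqrt (Q * R) * (l + Real.log 2) / 3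
      < ‖∑ k, y (ω k) • S.starProjection (EuclideanSpace.single (ω k) (1 : ℝ))‖)
    -- The inequality is non-strict, so outside this event the sampled norm is positive on `S` even
    -- if `γ = 1`, which yields invertibility.
    (fun ω => ∃ s ∈ S, s ≠ 0 ∧ ∑ k, s (ω k) ^ 2 ≤ (1 - γ) * (m / N) * ‖s‖ ^ 2) ?_ ?_ ?_ ?_ ?_
  · intro ω h₁ h₂ h₃ h₄
    rw [not_lt] at h₁ h₂ h₃
    push Not at h₄
    have hu : IsUnit ((sampleMat ω (lmat L U))ᵀ * sampleMat ω (lmat L U)) := by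
      refine isUnit_transpose_mul_self _ fun c' hc' => ?_
      by_contra hne0
      have hs0 : WithLp.toLp 2 (lmat L U *ᵥ c') ≠ 0 := fun h0 => by
        rw [WithLp.toLp_eq_zero] at h0
        exact hne0 (lmat_mulVec_injective L hG (h0.trans (Matrix.mulVec_zero _).symm))
      have h5 := h₄ _ (by rw [hS, mem_vectorSubspace_iff]; exact ⟨c', rfl⟩) hs0
      have h6 : ∀ k, (WithLp.toLp 2 (lmat L U *ᵥ c')) (ω k) = 0 := fun k => congrFun hc' k
      have h8 : ∑ k, (WithLp.toLp 2 (lmat L U *ᵥ c')) (ω k) ^ 2 = 0 :=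
        Finset.sum_eq_zero fun k _ => by rw [h6 k]; norm_num
      rw [h8] at h5
      have h7 : 0 ≤ (1 - γ) * (m / N) * ‖WithLp.toLp 2 (lmat L U *ᵥ c')‖ ^ 2 := by
        have : 0 ≤ 1 - γ := by linarith
        positivity
      linarith
    obtain ⟨⟨c', hc'⟩, hup⟩ := exists_residualEnergy_eq ω (lmat L U) hu y c
    rw [← hTy] at hc' hup
    have hE0 : 0 ≤ residualEnergy ω (lmat L U) (unfold T) := by rw [hc']; positivity
    have hα' : 0 < v → α = Real.sqrt (2 * (Q - v) / (m * v) * l)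
        + 2 * (Q - v) / (3 * (m * v)) * l := fun hvpos => by
      have e₁ : 2 * (N * Q - N * v) / (m * (N * v)) = 2 * (Q - v) / (m * v) := by field_simp
      have e₂ : 2 * (N * Q - N * v) / (3 * m * (N * v)) = 2 * (Q - v) / (3 * (m * v)) := by
        field_simp
      rw [hα, ← hNeq, hv, e₁, e₂]
    refine ⟨hu, fun hγlt => ?_, ?_⟩
    · rw [mul_assoc, henergy, ← hNeq, hcoh, div_mul_eq_mul_div, mul_comm N v, ← mul_assoc,
        mul_div_cancel_right₀ _ hN0.ne']
      have hg : 0 < 1 - γ := by linarith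
      rcases hv0.eq_or_lt with hvz | hvpos
      · rw [← hvz, mul_zero]
        exact hE0
      -- For `α ≥ 1` the lower bound is nonpositive.
      rcases le_or_gt 1 α with hα1 | hα1
      · refine le_trans (mul_nonpos_of_nonpos_of_nonneg ?_ hv0) hE0
        have h5 : m * (1 - α) ≤ 0 := mul_nonpos_of_nonneg_of_nonpos hm0.le (by linarith)
        have h6 : 0 ≤ N * R * (β / (1 - γ)) := by rw [hβ]; positivity
        linarith
      have hA := sampled_energy_lower hm0 hvpos hB hl0.le (hα' hvpos) h₂
      have hw := sampled_projection_sq_le hm0 hvpos hB hl4 hml hR0.le (norm_nonneg _)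
        (hα' hvpos) hα1 (by rw [add_sub_cancel]; exact h₃)
      rw [hβ]
      refine residual_lower hm0 hN0 hv0 hl0.le hγ0 hγlt hNR hA hw ?_
      rw [hc']
      have hsS : WithLp.toLp 2 (lmat L U *ᵥ c') ∈ S := by
        rw [hS, mem_vectorSubspace_iff]; exact ⟨c', rfl⟩
      refine sub_div_le_sum_sub_sq ω S y _ hsS (by positivity) ?_
      rcases eq_or_ne (WithLp.toLp 2 (lmat L U *ᵥ c')) 0 with h0 | h0
      · rw [h0]; simp
      · exact (h₄ _ hsS h0).le
    · rw [mul_assoc, henergy, ← hNeq]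
      have e : (1 + α) * (m / N) * (N * v) = (1 + α) * (m * v) := by field_simp
      rw [e]
      refine hup.trans ?_
      rcases hv0.eq_or_lt with hvz | hvpos
      · have hy0 : y = 0 := by
          rw [← hvz, mul_zero] at hv
          exact norm_eq_zero.1 (pow_eq_zero_iff two_ne_zero |>.1 hv)
        simp [hy0, ← hvz]
      · exact sampled_energy_upper hm0 hvpos hB hl0.le (hα' hvpos) h₁
  · rw [← hexpl]
    exact card_sampled_energy_gt y hv hQ hv0 hl0.le _ fun _ h => h
  · rw [← hexpl]
    exact card_sampled_energy_lt y hv hQ hv0 hl0.le _ fun _ h => h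
  · have h2 : 2 * Real.exp (-(l + Real.log 2)) = δ := by
      rw [neg_add, Real.exp_add, hexpl, Real.exp_neg, Real.exp_log two_pos]
      ring
    have := card_sampled_projection_gt y S hyS hR hR0.le hv hQ hv0
      (add_nonneg hl0.le (Real.log_nonneg one_le_two))
      (fun ω : Fin m → Fin n₁ × Fin n₃ => Real.sqrt (2 * (m * (R * v)) * (l + Real.log 2))
        + Real.sqrt (Q * R) * (l + Real.log 2) / 3
      < ‖∑ k, y (ω k) • S.starProjection (EuclideanSpace.single (ω k) (1 : ℝ))‖) fun _ h => h
    rwa [h2] at this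
  · refine (card_sampled_norm_le S hR0 hR hγ0 _ fun _ h => h).trans ?_
    refine mul_le_mul_of_nonneg_left ?_ (by positivity)
    refine finrank_mul_exp_le hdle hK hδ (by linarith) (by positivity) hm0 ?_
    rw [hγ2, hll, mul_assoc 2]
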